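/- **Conventions.** $\mathbb F$ is the skeleton of the category of finite sets with objects $n=\{1,\dots,n\}$; all 2-categories and 2-functors are strict, and $\mathbf{Cat}$ is the 2-category of small categories. *Theories.* A Lawvere 2-theory is a small 2-category $\mathbb T$ with an identity-on-objects 2-functor $\theta:\mathbb F^{op}\to\mathbb T$ such that the images of the projections exhibit $n$ as the $n$-th power of $1$, i.e. $\mathbb T(m,n)\cong\mathbb T(m,1)^n$ as categories. The 1-cells in the image of $\theta$ are called inert. *Models.* A model of $\mathbb T$ in $\mathbf{Cat}$ is a 2-functor $\mathcal X:\mathbb T\to\mathbf{Cat}$ with $\mathcal X(n)=X^n=\mathrm{Fun}(n,X)$, $X=\mathcal X(1)$, that sends inert 1-cells to the corresponding reindexing functors. A lax homomorphism $f:\mathcal X\to\mathcal Y$ is a lax natural transformation, with cells $f_\alpha:\mathcal Y(\alpha)f^m\Rightarrow f^n\mathcal X(\alpha)$ for $\alpha:m\to n$, whose component at $n$ is $f^n$ for a functor $f:X\to Y$, and whose cells at inert 1-cells are identities. A modification $t$ between lax homomorphisms is one with $t(n)=t(1)^n$. Models, lax homomorphisms and modifications form a 2-category $\mathsf{Mod}_l(\mathbb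 T,\mathbf{Cat})$ with hom-categories $\mathsf{Hom}_l(\mathcal X,\mathcal Y)$. Let $*$ be the terminal model. *Lax commutativity.* A lax commutativity on $\mathbb T$ consists of 2-functors $(-)\cdot n:\mathbb T\to\mathbb T$ and $m\cdot(-):\mathbb T\to\mathbb T$ for all $m,n$, both sending objects to products of numbers, and of 2-cells $$\sigma_{\alpha\beta}:(\alpha\cdot n')\circ(m\cdot\beta)\Rightarrow(m'\cdot\beta)\circ(\alpha\cdot n)\qquad(\alpha:m\to m',\ \beta:n\to n')$$ such that: on inert 1-cells the 2-functors are given by the product of finite sets; $(-)\cdot1$ and $1\cdot(-)$ are the identity; $\sigma_{\alpha\beta}$ is natural with respect to 2-cells in $\alpha$ and $\beta$ and compatible with composition of 1-cells in each variable; and $\sigma_{\alpha\beta}$ is an identity if $\alpha$ or $\beta$ is inert. *Internal homs.* Given a lax commutativity, the internal hom $\underline{\mathsf{Hom}}_l(\mathcal Y,\mathcal Z)$ is the model with underlying category $\mathsf{Hom}_l(\mathcal Y,\mathcal Z)$ in which $\alpha:m\to n$ acts by postcomposition with the lax homomorphism $\widetilde{\mathcal Z}(\alpha):\mathcal Z^m\to\mathcal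 Z^n$ whose underlying functor is $\mathcal Z(\alpha)$ and whose cell at $\beta$ is $\mathcal Z(\sigma_{\beta\alpha})$, and in which a 2-cell $s$ of $\mathbb T$ acts by $\mathcal Z(s)$. Put $\underline{\mathsf{IntAlg}}(\mathcal X)=\underline{\mathsf{Hom}}_l(*,\mathcal X)$. With lax homomorphisms $f$ acting by postcomposition, with cells given by the cells $f_\alpha$, and modifications acting by whiskering, this is an endo-2-functor of $\mathsf{Mod}_l(\mathbb T,\mathbf{Cat})$. *Eckmann–Hilton.* For a class $B$ of 1-cells with target $1$, let $\langle B\rangle$ be the smallest class of 1-cells with target $1$ that contains $\mathrm{id}_1$ and $B$ and is closed under operadic composition $(\alpha;\beta_1,\dots,\beta_n)\mapsto\alpha\circ(\beta_1\times\dots\times\beta_n)$. A basis is a class $B$ of non-inert 1-cells with target $1$ such that every 1-cell $m\to1$ equals $\alpha\circ\beta$ with $\beta$ inert and $\alpha\in\langle B\rangle$. A unit is a 1-cell $u:0\to1$; for $k\le n$ let $u_{k,n}:1\to n$ be the 1-cell with $k$-th component $\mathrm{id}_1$ and all other components $1\to0\xrightarrow{u}1$. A 1-cell $\alpha:n\to1$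 is unital if there is a unit $u$ such that $\alpha\circ u_{k,n}\cong\mathrm{id}_1$ for every $k\le n$. A lax commutative Lawvere 2-theory is Eckmann–Hilton if there is a basis $B$ such that 1. $B$ contains no 1-cell $1\to1$; 2. each $\alpha:n\to1$ in $B$ with $n\ge2$ is unital; 3. $\sigma_{\alpha\alpha}$ is invertible for each $\alpha\in B$; 4. $\sigma_{uv}$ is invertible for any two units $u,v$. **Theorem** (partial generalized Fox theorem). Let $\mathbb T$ be a lax commutative Lawvere 2-theory. Then the endo-2-functor $\underline{\mathsf{IntAlg}}=\underline{\mathsf{Hom}}_l(*,-)$ of $\mathsf{Mod}_l(\mathbb T,\mathbf{Cat})$ carries the structure of a 2-comonad $(\underline{\mathsf{IntAlg}},\Delta,\varepsilon)$ whose counit $\varepsilon_{\mathcal X}:\underline{\mathsf{IntAlg}}(\mathcal X)\to\mathcal X$ is the strict homomorphism given by evaluation at the unique object of $*$. If $\mathbb T$ is moreover Eckmann–Hilton, this 2-comonad is idempotent, i.e. each comultiplication component $\Delta_{\mathcal X}:\underline{\mathsf{IntAlg}}(\mathcal X)\to\underline{\mathsf{IntAlg}}(\underline{\mathsf{IntAlg}}(\mathcal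 X))$ is an isomorphism in $\mathsf{Mod}_l(\mathbb T,\mathbf{Cat})$. -/

import Mathlib

open CategoryTheory Bicategory

set_option linter.unusedVariables false
set_option linter.checkUnivs false

universe w u

/-- The objects of a skeleton of the category of finite sets: `m` stands for the finite set
`Fin m.card`. -/
structure Arity : Type where
  card : ℕ

/-- A Lawvere 2-theory: a strict 2-category whose objects are the finite sets `m`, with an
identity-on-objects 2-functor `inert` from the opposite of the category of finite sets (a map of
sets `p : n → m` gives a 1-cell `m ⟶ n`), such that `m` is the `m`-fold power of `1`, for 1-cells
and for 2-cells, with the projections `inert (fun _ => i)`. -/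
structure LawvereTwoTheory where
  bicategory : Bicategory.{w, u} Arity
  strict : Bicategory.Strict Arity
  inert {m n : Arity} (p : Fin n.card → Fin m.card) : m ⟶ n
  inert_id (m : Arity) : inert (id : Fin m.card → Fin m.card) = 𝟙 m
  inert_comp {m n k : Arity} (p : Fin n.card → Fin m.card) (q : Fin k.card → Fin n.card) :
    inert (p ∘ q) = inert p ≫ inert q
  existsUnique_tuple {m n : Arity} (a : Fin n.card → (m ⟶ Arity.mk 1)) :
    ∃! α : m ⟶ n, ∀ i : Fin n.card, α ≫ inert (fun _ => i) = a i
  existsUnique_tuple₂ {m n : Arity} (α β : m ⟶ n)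
    (s : ∀ i : Fin n.card,
      α ≫ inert (n := Arity.mk 1) (fun _ => i) ⟶ β ≫ inert (n := Arity.mk 1) (fun _ => i)) :
    ∃! t : α ⟶ β, ∀ i : Fin n.card, t ▷ inert (fun _ => i) = s i

namespace LawvereTwoTheory

variable (T : LawvereTwoTheory.{w, u})

/-- The objects of the 2-category `T`. -/
def Ob (_ : LawvereTwoTheory.{w, u}) : Type := Arity

instance : Bicategory.{w, u} T.Ob := T.bicategory

instance : Bicategory.Strict T.Ob := T.strict

variable {T}

namespace Ob

def card (m : T.Ob) : ℕ := Arity.card m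

/-- The elements of the finite set `m`. -/
abbrev Ix (m : T.Ob) : Type := Fin m.card

def zero : T.Ob := Arity.mk 0

def one : T.Ob := Arity.mk 1

/-- The element of the one-element set. -/
def pt : (one : T.Ob).Ix := (0 : Fin 1)

theorem eq_pt (i : (one : T.Ob).Ix) : i = pt := Subsingleton.elim (α := Fin 1) i pt

/-- The cartesian product of finite sets. -/
def mul (m n : T.Ob) : T.Ob := Arity.mk (m.card * n.card)

def pair {m n : T.Ob} (i : m.Ix) (j : n.Ix) : (m.mul n).Ix := finProdFinEquiv (i, j)

def fst {m n : T.Ob} (k : (m.mul n).Ix) : m.Ix := (finProdFinEquiv.symm k).1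

def snd {m n : T.Ob} (k : (m.mul n).Ix) : n.Ix := (finProdFinEquiv.symm k).2

@[simp] theorem fst_pair {m n : T.Ob} (i : m.Ix) (j : n.Ix) : fst (pair i j) = i :=
  congrArg Prod.fst (finProdFinEquiv.symm_apply_apply (i, j))

@[simp] theorem snd_pair {m n : T.Ob} (i : m.Ix) (j : n.Ix) : snd (pair i j) = j :=
  congrArg Prod.snd (finProdFinEquiv.symm_apply_apply (i, j))

@[simp] theorem pair_fst_snd {m n : T.Ob} (k : (m.mul n).Ix) : pair (fst k) (snd k) = k :=
  finProdFinEquiv.apply_symm_apply k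

/-- The coproduct of a finite family of finite sets. -/
def sum {n : T.Ob} (k : n.Ix → T.Ob) : T.Ob := Arity.mk (∑ i, (k i).card)

/-- The inclusion of the `i`-th summand into a coproduct. -/
def incl {n : T.Ob} (k : n.Ix → T.Ob) (i : n.Ix) (j : (k i).Ix) : (sum k).Ix :=
  finSigmaFinEquiv (n := fun i => (k i).card) ⟨i, j⟩

end Ob

open Ob

/-- The inert 1-cell `m ⟶ n` of a map of finite sets `n → m`. -/
def θ {m n : T.Ob} (p : n.Ix → m.Ix) : m ⟶ n := T.inert p

theorem θ_id (m : T.Ob) : θ (id : m.Ix → m.Ix) = 𝟙 m := T.inert_id m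

theorem θ_comp {m n k : T.Ob} (p : n.Ix → m.Ix) (q : k.Ix → n.Ix) :
    θ (p ∘ q) = θ p ≫ θ q := T.inert_comp p q

/-- The `i`-th projection `n ⟶ 1`. -/
def proj {n : T.Ob} (i : n.Ix) : n ⟶ one := θ fun _ => i

/-- A strict 2-functor from `T` to itself with the prescribed action `φ` on objects. -/
structure TwoFunctorOver (φ : T.Ob → T.Ob) where
  map {m n : T.Ob} (α : m ⟶ n) : φ m ⟶ φ n
  map₂ {m n : T.Ob} {α β : m ⟶ n} (s : α ⟶ β) : map α ⟶ map β
  map_id (m : T.Ob) : map (𝟙 m) = 𝟙 (φ m)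
  map_comp {m n k : T.Ob} (α : m ⟶ n) (β : n ⟶ k) : map (α ≫ β) = map α ≫ map β
  map₂_id {m n : T.Ob} (α : m ⟶ n) : map₂ (𝟙 α) = 𝟙 (map α)
  map₂_comp {m n : T.Ob} {α β γ : m ⟶ n} (s : α ⟶ β) (t : β ⟶ γ) :
    map₂ (s ≫ t) = map₂ s ≫ map₂ t
  map₂_whiskerLeft {m n k : T.Ob} (α : m ⟶ n) {β γ : n ⟶ k} (s : β ⟶ γ) :
    map₂ (α ◁ s) ≍ map α ◁ map₂ s
  map₂_whiskerRight {m n k : T.Ob} {α β : m ⟶ n} (s : α ⟶ β) (γ : n ⟶ k) :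
    map₂ (s ▷ γ) ≍ map₂ s ▷ map γ

variable (T)

/-- A lax commutativity on a Lawvere 2-theory: a multiplication `μ` from the lax Gray tensor product
of `T` with itself to `T`, given on objects by the product of finite sets and extending the product
of finite sets on inert 1-cells, with the one-element set as a unit. A 2-functor out of the Gray
tensor product is given by 2-functors `left n = μ(-, n)` and `right m = μ(m, -)`, with common values
on objects, and a 2-cell `gray α β`, the image of the Gray cell of `α` and `β`, for all 1-cells
`α` and `β`, natural in and multiplicative in both variables; it is an identity as soon as `α` or
`β` is inert. Unitality is expressed through the inert isomorphisms between `m * 1`, `1 * m` and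
`m`. Associativity needs no axiom: the 2-cells into a power are determined by their components, and
the components of the cells above are recovered from the unit laws. -/
structure LaxCommutativity where
  left (n : T.Ob) : T.TwoFunctorOver fun m => m.mul n
  right (m : T.Ob) : T.TwoFunctorOver fun n => m.mul n
  left_inert (n : T.Ob) {m m' : T.Ob} (p : m'.Ix → m.Ix) :
    (left n).map (θ p) = θ fun k => pair (p (fst k)) (snd k)
  right_inert (m : T.Ob) {n n' : T.Ob} (q : n'.Ix → n.Ix) :
    (right m).map (θ q) = θ fun k => pair (fst k) (q (snd k))
  left_one {m m' : T.Ob} (α : m ⟶ m') :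
    (left one).map α ≫ θ (fun i => pair i pt) = θ (fun i => pair i pt) ≫ α
  left_one₂ {m m' : T.Ob} {α α' : m ⟶ m'} (s : α ⟶ α') :
    (left one).map₂ s ▷ θ (fun i => pair i pt) ≍
      θ (fun i : m.Ix => pair i (pt : (one : T.Ob).Ix)) ◁ s
  right_one {n n' : T.Ob} (β : n ⟶ n') :
    (right one).map β ≫ θ (fun j => pair pt j) = θ (fun j => pair pt j) ≫ β
  right_one₂ {n n' : T.Ob} {β β' : n ⟶ n'} (s : β ⟶ β') :
    (right one).map₂ s ▷ θ (fun j => pair pt j) ≍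
      θ (fun j : n.Ix => pair (pt : (one : T.Ob).Ix) j) ◁ s
  gray {m m' n n' : T.Ob} (α : m ⟶ m') (β : n ⟶ n') :
    (right m).map β ≫ (left n').map α ⟶ (left n).map α ≫ (right m').map β
  gray_natural_left {m m' n n' : T.Ob} {α α' : m ⟶ m'} (s : α ⟶ α') (β : n ⟶ n') :
    (right m).map β ◁ (left n').map₂ s ≫ gray α' β =
      gray α β ≫ (left n).map₂ s ▷ (right m').map β
  gray_natural_right {m m' n n' : T.Ob} (α : m ⟶ m') {β β' : n ⟶ n'} (s : β ⟶ β') :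
    (right m).map₂ s ▷ (left n').map α ≫ gray α β' =
      gray α β ≫ (left n).map α ◁ (right m').map₂ s
  gray_comp_left {m m' m'' n n' : T.Ob} (α : m ⟶ m') (α' : m' ⟶ m'') (β : n ⟶ n') :
    gray (α ≫ α') β =
      eqToHom (by rw [(left n').map_comp, Category.assoc]) ≫
        gray α β ▷ (left n').map α' ≫ (α_ _ _ _).hom ≫ (left n).map α ◁ gray α' β ≫
        eqToHom (by rw [(left n).map_comp, Category.assoc])
  gray_comp_right {m m' n n' n'' : T.Ob} (α : m ⟶ m') (β : n ⟶ n') (β' : n' ⟶ n'') :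
    gray α (β ≫ β') =
      eqToHom (by rw [(right m).map_comp, Category.assoc]) ≫
        (right m).map β ◁ gray α β' ≫ (α_ _ _ _).inv ≫ gray α β ▷ (right m').map β' ≫
        eqToHom (by rw [(right m').map_comp, Category.assoc])
  gray_inert_left {m m' n n' : T.Ob} (p : m'.Ix → m.Ix) (β : n ⟶ n') :
    ∃ h, gray (θ p) β = eqToHom h
  gray_inert_right {m m' n n' : T.Ob} (α : m ⟶ m') (q : n'.Ix → n.Ix) :
    ∃ h, gray α (θ q) = eqToHom h

variable {T}

namespace LaxCommutativity

variable (μ : T.LaxCommutativity)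

theorem left_col (n : T.Ob) {m m' : T.Ob} (β : m ⟶ m') (i : n.Ix) :
    (μ.left n).map β ≫ θ (fun j => pair j i) = θ (fun j => pair j i) ≫ β := by
  obtain ⟨h, -⟩ := μ.gray_inert_right β (n := n) (n' := one) (fun _ => i)
  have e (k : T.Ob) : θ (fun j : k.Ix => pair j i) =
      (μ.right k).map (n := one) (θ fun _ => i) ≫ θ (fun j => pair j pt) := by
    rw [μ.right_inert, ← θ_comp]
    congr 1
    funext j
    simp
  rw [e, e, ← Category.assoc, ← h, Category.assoc, μ.left_one, Category.assoc]

theorem right_row (m : T.Ob) {n n' : T.Ob} (α : n ⟶ n') (j : m.Ix) :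
    (μ.right m).map α ≫ θ (fun i => pair j i) = θ (fun i => pair j i) ≫ α := by
  obtain ⟨h, -⟩ := μ.gray_inert_left (m := m) (m' := one) (fun _ => j) α
  have e (k : T.Ob) : θ (fun i : k.Ix => pair j i) =
      (μ.left k).map (n := one) (θ fun _ => j) ≫ θ (fun i => pair pt i) := by
    rw [μ.left_inert, ← θ_comp]
    congr 1
    funext i
    simp
  rw [e, e, ← Category.assoc, h, Category.assoc, μ.right_one, Category.assoc]

end LaxCommutativity

end LawvereTwoTheory

open LawvereTwoTheory LawvereTwoTheory.Ob

/-! Bookkeeping for heterogeneous equalities of morphisms. -/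

theorem comp_hcongr {C : Type*} [Category C] {a b c a' b' c' : C} {f : a ⟶ b} {g : b ⟶ c}
    {f' : a' ⟶ b'} {g' : b' ⟶ c'} (ha : a = a') (hb : b = b') (hc : c = c')
    (hf : f ≍ f') (hg : g ≍ g') : f ≫ g ≍ f' ≫ g' := by
  subst ha hb hc hf hg; rfl

theorem map_hcongr {C D : Type*} [Category C] [Category D] (F : C ⥤ D) {a b a' b' : C}
    {f : a ⟶ b} {f' : a' ⟶ b'} (ha : a = a') (hb : b = b') (hf : f ≍ f') :
    F.map f ≍ F.map f' := by
  subst ha hb hf; rfl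

theorem app_hcongr {C D : Type*} [Category C] [Category D] {F G : C ⥤ D} (t : F ⟶ G)
    {a a' : C} (ha : a = a') : t.app a ≍ t.app a' := by
  subst ha; rfl

theorem tuple_hcongr {I C : Type*} [Category C] {x y x' y' : I → C} {f : ∀ i, x i ⟶ y i}
    {f' : ∀ i, x' i ⟶ y' i} (hx : ∀ i, x i = x' i) (hy : ∀ i, y i = y' i)
    (h : ∀ i, f i ≍ f' i) : f ≍ f' := by
  obtain rfl := funext hx
  obtain rfl := funext hy
  exact heq_of_eq (funext fun i => eq_of_heq (h i))

theorem id_hcongr {C : Type*} [Category C] {a b : C} (h : a = b) : 𝟙 a ≍ 𝟙 b := by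
  subst h; rfl

theorem comp_heq_left {C : Type*} [Category C] {a b c d : C} {f : a ⟶ b} {g : b ⟶ c}
    (h : b = c) (hd : b = d) (hg : g ≍ 𝟙 d) : f ≫ g ≍ f := by
  subst h hd; rw [eq_of_heq hg, Category.comp_id]

theorem comp_heq_right {C : Type*} [Category C] {a b c d : C} {f : a ⟶ b} {g : b ⟶ c}
    (h : a = b) (hd : a = d) (hf : f ≍ 𝟙 d) : f ≫ g ≍ g := by
  subst h hd; rw [eq_of_heq hf, Category.id_comp]

/-- A model of the Lawvere 2-theory `T` in small categories: a strict 2-functor from `T` to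
categories, with value the chosen power `Fin m → C` at `m`, sending inert 1-cells to the
corresponding reindexing functors. A functor to the power `Fin n → C` is given as the family of
its `n` components, so that `op α i` is the `i`-th component of the functor assigned to `α`, and
similarly for natural transformations. -/
structure Model (T : LawvereTwoTheory.{w, u}) where
  C : Type u
  [cat : SmallCategory C]
  op {m n : T.Ob} (α : m ⟶ n) (i : n.Ix) : (m.Ix → C) ⥤ C
  op₂ {m n : T.Ob} {α β : m ⟶ n} (s : α ⟶ β) (i : n.Ix) : op α i ⟶ op β i
  op_comp {m n k : T.Ob} (α : m ⟶ n) (β : n ⟶ k) (i : k.Ix) :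
    op (α ≫ β) i = Functor.pi' (op α) ⋙ op β i
  op_inert {m n : T.Ob} (p : n.Ix → m.Ix) (i : n.Ix) : op (θ p) i = Pi.eval (fun _ => C) (p i)
  op₂_id {m n : T.Ob} (α : m ⟶ n) (i : n.Ix) : op₂ (𝟙 α) i = 𝟙 (op α i)
  op₂_comp {m n : T.Ob} {α β γ : m ⟶ n} (s : α ⟶ β) (t : β ⟶ γ) (i : n.Ix) :
    op₂ (s ≫ t) i = op₂ s i ≫ op₂ t i
  op₂_whiskerLeft {m n k : T.Ob} (α : m ⟶ n) {β γ : n ⟶ k} (s : β ⟶ γ) (i : k.Ix)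
    (x : m.Ix → C) : (op₂ (α ◁ s) i).app x ≍ (op₂ s i).app fun j => (op α j).obj x
  op₂_whiskerRight {m n k : T.Ob} {α β : m ⟶ n} (s : α ⟶ β) (γ : n ⟶ k) (i : k.Ix)
    (x : m.Ix → C) : (op₂ (s ▷ γ) i).app x ≍ (op γ i).map fun j => (op₂ s j).app x

attribute [instance] Model.cat

variable {T : LawvereTwoTheory.{w, u}}

namespace Model

variable (X : Model T)

theorem op_comp_obj {m n k : T.Ob} (α : m ⟶ n) (β : n ⟶ k) (i : k.Ix) (x : m.Ix → X.C) :
    (X.op (α ≫ β) i).obj x = (X.op β i).obj fun j => (X.op α j).obj x := by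
  rw [X.op_comp]; rfl

theorem op_comp_map {m n k : T.Ob} (α : m ⟶ n) (β : n ⟶ k) (i : k.Ix) {x y : m.Ix → X.C}
    (f : x ⟶ y) : (X.op (α ≫ β) i).map f ≍ (X.op β i).map fun j => (X.op α j).map f := by
  rw [X.op_comp]; rfl

theorem op_inert_obj {m n : T.Ob} (p : n.Ix → m.Ix) (i : n.Ix) (x : m.Ix → X.C) :
    (X.op (θ p) i).obj x = x (p i) := by
  rw [X.op_inert]; rfl

theorem op_inert_map {m n : T.Ob} (p : n.Ix → m.Ix) (i : n.Ix) {x y : m.Ix → X.C} (f : x ⟶ y) :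
    (X.op (θ p) i).map f ≍ f (p i) := by
  rw [X.op_inert]; rfl

theorem op_map_id {m n : T.Ob} (α : m ⟶ n) (i : n.Ix) (x : m.Ix → X.C) :
    (X.op α i).map (fun k => 𝟙 (x k)) = 𝟙 ((X.op α i).obj x) :=
  (X.op α i).map_id x

theorem op_map_comp {m n : T.Ob} (α : m ⟶ n) (i : n.Ix) {x y z : m.Ix → X.C}
    (f : ∀ k, x k ⟶ y k) (g : ∀ k, y k ⟶ z k) :
    (X.op α i).map (fun k => f k ≫ g k) = (X.op α i).map f ≫ (X.op α i).map g :=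
  (X.op α i).map_comp f g

theorem op_map_hcongr {m n : T.Ob} (α : m ⟶ n) (i : n.Ix) {x y x' y' : m.Ix → X.C}
    {f : ∀ k, x k ⟶ y k} {f' : ∀ k, x' k ⟶ y' k} (hx : ∀ k, x k = x' k) (hy : ∀ k, y k = y' k)
    (h : ∀ k, f k ≍ f' k) : (X.op α i).map f ≍ (X.op α i).map f' := by
  obtain rfl := funext hx
  obtain rfl := funext hy
  exact heq_of_eq (congrArg _ (funext fun k => eq_of_heq (h k)))

theorem op_map_heq_id {m n : T.Ob} (α : m ⟶ n) (i : n.Ix) {x y z : m.Ix → X.C}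
    {f : ∀ k, x k ⟶ y k} (hx : ∀ k, x k = z k) (hy : ∀ k, y k = z k) (h : ∀ k, f k ≍ 𝟙 (z k)) :
    (X.op α i).map f ≍ 𝟙 ((X.op α i).obj z) :=
  (X.op_map_hcongr α i hx hy h).trans (heq_of_eq (X.op_map_id α i z))

theorem op₂_naturality {m n : T.Ob} {α β : m ⟶ n} (s : α ⟶ β) (i : n.Ix) {x y : m.Ix → X.C}
    (f : ∀ k, x k ⟶ y k) :
    (X.op α i).map f ≫ (X.op₂ s i).app y = (X.op₂ s i).app x ≫ (X.op β i).map f :=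
  (X.op₂ s i).naturality f

theorem op₂_hcongr {m n : T.Ob} {α β α' β' : m ⟶ n} {s : α ⟶ β} {s' : α' ⟶ β'}
    (hα : α = α') (hβ : β = β') (hs : s ≍ s') (i : n.Ix) (x : m.Ix → X.C) :
    (X.op₂ s i).app x ≍ (X.op₂ s' i).app x := by
  subst hα hβ hs; rfl

theorem op₂_comp_app {m n : T.Ob} {α β γ : m ⟶ n} (s : α ⟶ β) (t : β ⟶ γ) (i : n.Ix)
    (x : m.Ix → X.C) : (X.op₂ (s ≫ t) i).app x = (X.op₂ s i).app x ≫ (X.op₂ t i).app x := by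
  rw [X.op₂_comp]; rfl

theorem op₂_eqToHom_app {m n : T.Ob} {α β : m ⟶ n} (h : α = β) (i : n.Ix) (x : m.Ix → X.C) :
    (X.op₂ (eqToHom h) i).app x ≍ 𝟙 ((X.op α i).obj x) := by
  subst h; simp [X.op₂_id]

end Model

/-- A lax homomorphism `X ⟶ Y` of models: a lax natural transformation whose component at `m`
is the `m`-th power of the functor `F`, with identity cells at inert 1-cells. -/
structure LaxHom (X Y : Model T) where
  F : X.C ⥤ Y.C
  cell {m n : T.Ob} (α : m ⟶ n) (x : m.Ix → X.C) (i : n.Ix) :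
    (Y.op α i).obj (fun k => F.obj (x k)) ⟶ F.obj ((X.op α i).obj x)
  cell_naturality {m n : T.Ob} (α : m ⟶ n) {x y : m.Ix → X.C} (a : x ⟶ y) (i : n.Ix) :
    (Y.op α i).map (fun k => F.map (a k)) ≫ cell α y i = cell α x i ≫ F.map ((X.op α i).map a)
  cell_op₂ {m n : T.Ob} {α β : m ⟶ n} (s : α ⟶ β) (x : m.Ix → X.C) (i : n.Ix) :
    cell α x i ≫ F.map ((X.op₂ s i).app x) =
      (Y.op₂ s i).app (fun k => F.obj (x k)) ≫ cell β x i
  cell_inert {m n : T.Ob} (p : n.Ix → m.Ix) (x : m.Ix → X.C) (i : n.Ix) :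
    cell (θ p) x i ≍ 𝟙 (F.obj (x (p i)))
  cell_comp {m n k : T.Ob} (α : m ⟶ n) (β : n ⟶ k) (x : m.Ix → X.C) (i : k.Ix) :
    cell (α ≫ β) x i ≍
      (Y.op β i).map (fun j => cell α x j) ≫ cell β (fun j => (X.op α j).obj x) i

namespace LaxHom

variable {X Y Z W : Model T}

theorem hext {f g : LaxHom X Y} (hobj : ∀ x, f.F.obj x = g.F.obj x)
    (hmap : ∀ {x y : X.C} (a : x ⟶ y), f.F.map a ≍ g.F.map a)
    (hcell : ∀ {m n : T.Ob} (α : m ⟶ n) (x : m.Ix → X.C) (i : n.Ix),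
      f.cell α x i ≍ g.cell α x i) : f = g := by
  have hF : f.F = g.F := Functor.hext hobj fun _ _ a => hmap a
  obtain ⟨F, cf, _, _, _, _⟩ := f
  obtain ⟨G, cg, _, _, _, _⟩ := g
  obtain rfl : F = G := hF
  obtain rfl : @cf = @cg := by
    funext m n α x i
    exact eq_of_heq (hcell α x i)
  rfl

/-- A modification between lax homomorphisms; it is determined by its component `app` at `1`. -/
@[ext] structure Modif (f g : LaxHom X Y) where
  app : f.F ⟶ g.F
  comm {m n : T.Ob} (α : m ⟶ n) (x : m.Ix → X.C) (i : n.Ix) :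
    f.cell α x i ≫ app.app ((X.op α i).obj x) =
      (Y.op α i).map (fun k => app.app (x k)) ≫ g.cell α x i

theorem Modif.hext {f g f' g' : LaxHom X Y} {s : Modif f g} {t : Modif f' g'} (hf : f = f')
    (hg : g = g') (h : ∀ x, s.app.app x ≍ t.app.app x) : s ≍ t := by
  subst hf hg
  exact heq_of_eq (Modif.ext (NatTrans.ext (funext fun x => eq_of_heq (h x))))

instance : Category (LaxHom X Y) where
  Hom := Modif
  id f :=
    { app := 𝟙 f.F
      comm := fun α x i => by simp [Y.op_map_id] }
  comp {f g h} s t :=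
    { app := s.app ≫ t.app
      comm := fun α x i => by
        simp only [NatTrans.comp_app]
        rw [Y.op_map_comp, ← Category.assoc, s.comm, Category.assoc, t.comm, Category.assoc] }
  id_comp s := Modif.ext (Category.id_comp _)
  comp_id s := Modif.ext (Category.comp_id _)
  assoc r s t := Modif.ext (Category.assoc _ _ _)

@[simp] theorem id_app (f : LaxHom X Y) : Modif.app (𝟙 f) = 𝟙 f.F := rfl

@[simp] theorem comp_app {f g h : LaxHom X Y} (s : f ⟶ g) (t : g ⟶ h) :
    Modif.app (s ≫ t) = s.app ≫ t.app := rfl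

theorem hom_ext {f g : LaxHom X Y} {s t : f ⟶ g} (h : ∀ x, s.app.app x = t.app.app x) :
    s = t :=
  Modif.ext (NatTrans.ext (funext h))

theorem hom_hext {f g f' g' : LaxHom X Y} {s : f ⟶ g} {t : f' ⟶ g'} (hf : f = f')
    (hg : g = g') (h : ∀ x, s.app.app x ≍ t.app.app x) : s ≍ t :=
  Modif.hext hf hg h

theorem eqToHom_app {f g : LaxHom X Y} (h : f = g) (x : X.C) :
    (Modif.app (eqToHom h)).app x ≍ 𝟙 (f.F.obj x) := by
  subst h; rfl

/-- The identity homomorphism. -/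
def idHom (X : Model T) : LaxHom X X where
  F := 𝟭 X.C
  cell α x i := 𝟙 ((X.op α i).obj x)
  cell_naturality α x y a i := (Category.comp_id _).trans (Category.id_comp _).symm
  cell_op₂ s x i := (Category.id_comp _).trans (Category.comp_id _).symm
  cell_inert p x i := id_hcongr (X.op_inert_obj p i x)
  cell_comp α β x i := by
    refine (id_hcongr (X.op_comp_obj α β i x)).trans (heq_of_eq ?_)
    exact ((congrArg (· ≫ 𝟙 _) (X.op_map_id β i fun j => (X.op α j).obj x)).trans
      (Category.id_comp _)).symm

/-- Composition of lax homomorphisms, by pasting of cells. -/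
def comp (f : LaxHom X Y) (g : LaxHom Y Z) : LaxHom X Z where
  F := f.F ⋙ g.F
  cell α x i := g.cell α (fun k => f.F.obj (x k)) i ≫ g.F.map (f.cell α x i)
  cell_naturality α x y a i := by
    have h := g.cell_naturality α (fun k => f.F.map (a k)) i
    simp only [Functor.comp_map]
    rw [← Category.assoc, h, Category.assoc, ← g.F.map_comp, f.cell_naturality, g.F.map_comp,
      Category.assoc]
  cell_op₂ s x i := by
    simp only [Functor.comp_map, Functor.comp_obj]
    rw [Category.assoc, ← g.F.map_comp, f.cell_op₂, g.F.map_comp, ← Category.assoc, g.cell_op₂,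
      Category.assoc]
  cell_inert p x i := by
    have h : g.F.map (f.cell (θ p) x i) ≍ 𝟙 (g.F.obj (f.F.obj (x (p i)))) :=
      (map_hcongr g.F (Y.op_inert_obj _ _ _) (by rw [X.op_inert_obj]) (f.cell_inert p x i)).trans
        (heq_of_eq (g.F.map_id _))
    refine (comp_heq_left ?_ ?_ h).trans (g.cell_inert p _ i)
    · rw [X.op_inert_obj, Y.op_inert_obj]
    · rw [Y.op_inert_obj]
  cell_comp α β x i := by
    refine (comp_hcongr ?_ ?_ ?_ (g.cell_comp α β _ i)
      (map_hcongr g.F ?_ ?_ (f.cell_comp α β x i))).trans (heq_of_eq ?_)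
    · exact Z.op_comp_obj α β i _
    · rw [Y.op_comp_obj]
    · rw [X.op_comp_obj]
    · rw [Y.op_comp_obj]
    · rw [X.op_comp_obj]
    · have h := g.cell_naturality β (fun j => f.cell α x j) i
      simp only [Z.op_map_comp, g.F.map_comp, Category.assoc]
      congr 1
      rw [← Category.assoc, ← Category.assoc, h]

end LaxHom

namespace LaxHom

variable {X Y Z W : Model T}

/-- Whiskering of a modification with a lax homomorphism. -/
def whiskerL (f : LaxHom X Y) {g h : LaxHom Y Z} (t : g ⟶ h) : comp f g ⟶ comp f h where
  app := Functor.whiskerLeft f.F t.app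
  comm α x i := by
    have h1 := t.comm α (fun k => f.F.obj (x k)) i
    have h2 := t.app.naturality (f.cell α x i)
    simp only [comp, Functor.whiskerLeft_app, Functor.comp_obj, Category.assoc] at h1 h2 ⊢
    rw [h2, ← Category.assoc, h1, Category.assoc]

/-- Whiskering of a modification with a lax homomorphism. -/
def whiskerR {f g : LaxHom X Y} (t : f ⟶ g) (h : LaxHom Y Z) : comp f h ⟶ comp g h where
  app := Functor.whiskerRight t.app h.F
  comm α x i := by
    have h1 := h.cell_naturality α (fun k => t.app.app (x k)) i
    have h2 := t.comm α x i
    simp only [comp, Functor.whiskerRight_app, Functor.comp_obj, Category.assoc]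
    rw [← h.F.map_comp, h2, h.F.map_comp, ← Category.assoc, ← h1, Category.assoc]

theorem comp_assoc (f : LaxHom X Y) (g : LaxHom Y Z) (h : LaxHom Z W) :
    comp (comp f g) h = comp f (comp g h) :=
  hext (fun _ => rfl) (fun _ => HEq.rfl) fun α x i => heq_of_eq (by simp [comp])

theorem id_comp (f : LaxHom X Y) : comp (idHom X) f = f :=
  hext (fun _ => rfl) (fun _ => HEq.rfl) fun α x i => heq_of_eq (by simp [comp, idHom])

theorem comp_id (f : LaxHom X Y) : comp f (idHom Y) = f :=
  hext (fun _ => rfl) (fun _ => HEq.rfl) fun α x i => heq_of_eq (by simp [comp, idHom])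

theorem eqToHom_app_eq {f g : LaxHom X Y} (h : f = g) (x : X.C) (e : f.F.obj x = g.F.obj x) :
    (Modif.app (eqToHom h)).app x = eqToHom e := by
  subst h; rfl

def assocIso (f : LaxHom X Y) (g : LaxHom Y Z) (h : LaxHom Z W) :
    comp (comp f g) h ≅ comp f (comp g h) where
  hom :=
    { app := 𝟙 (f.F ⋙ g.F ⋙ h.F)
      comm := fun α x i => by
        simp [comp, W.op_map_id α i fun k => h.F.obj (g.F.obj (f.F.obj (x k)))] }
  inv :=
    { app := 𝟙 (f.F ⋙ g.F ⋙ h.F)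
      comm := fun α x i => by
        simp [comp, W.op_map_id α i fun k => h.F.obj (g.F.obj (f.F.obj (x k)))] }
  hom_inv_id := hom_ext fun _ => Category.id_comp _
  inv_hom_id := hom_ext fun _ => Category.id_comp _

def leftIso (f : LaxHom X Y) : comp (idHom X) f ≅ f where
  hom :=
    { app := 𝟙 (f.F)
      comm := fun α x i => by
        simp [comp, idHom, Y.op_map_id α i fun k => f.F.obj (x k)] }
  inv :=
    { app := 𝟙 (f.F)
      comm := fun α x i => by
        simp [comp, idHom, Y.op_map_id α i fun k => f.F.obj (x k)] }
  hom_inv_id := hom_ext fun _ => Category.id_comp _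
  inv_hom_id := hom_ext fun _ => Category.id_comp _

def rightIso (f : LaxHom X Y) : comp f (idHom Y) ≅ f where
  hom :=
    { app := 𝟙 (f.F)
      comm := fun α x i => by
        simp [comp, idHom, Y.op_map_id α i fun k => f.F.obj (x k)] }
  inv :=
    { app := 𝟙 (f.F)
      comm := fun α x i => by
        simp [comp, idHom, Y.op_map_id α i fun k => f.F.obj (x k)] }
  hom_inv_id := hom_ext fun _ => Category.id_comp _
  inv_hom_id := hom_ext fun _ => Category.id_comp _

end LaxHom

/-- The strict 2-category of models, lax homomorphisms and modifications. -/
instance : Bicategory (Model T) where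
  Hom X Y := LaxHom X Y
  id X := LaxHom.idHom X
  comp f g := LaxHom.comp f g
  whiskerLeft f _ _ t := LaxHom.whiskerL f t
  whiskerRight t h := LaxHom.whiskerR t h
  associator f g h := LaxHom.assocIso f g h
  leftUnitor f := LaxHom.leftIso f
  rightUnitor f := LaxHom.rightIso f
  whiskerLeft_id f g := LaxHom.hom_ext fun x => rfl
  whiskerLeft_comp f g h i s t := LaxHom.hom_ext fun x => rfl
  id_whiskerLeft t := LaxHom.hom_ext fun x =>
    ((Category.id_comp _).trans (Category.comp_id _)).symm
  comp_whiskerLeft f g h h' t := LaxHom.hom_ext fun x =>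
    ((Category.id_comp _).trans (Category.comp_id _)).symm
  id_whiskerRight f g := LaxHom.hom_ext fun x => g.F.map_id _
  comp_whiskerRight s t i := LaxHom.hom_ext fun x => i.F.map_comp _ _
  whiskerRight_id t := LaxHom.hom_ext fun x =>
    ((Category.id_comp _).trans (Category.comp_id _)).symm
  whiskerRight_comp t g h := LaxHom.hom_ext fun x =>
    ((Category.id_comp _).trans (Category.comp_id _)).symm
  whisker_assoc f _ _ t h := LaxHom.hom_ext fun x =>
    ((Category.id_comp _).trans (Category.comp_id _)).symm
  whisker_exchange s t := LaxHom.hom_ext fun x =>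
    (NatTrans.naturality (LaxHom.Modif.app t) ((LaxHom.Modif.app s).app x)).symm
  pentagon f g h i := LaxHom.hom_ext fun x =>
    congrArg₂ (· ≫ ·) (i.F.map_id (h.F.obj (g.F.obj (f.F.obj x)))) (Category.id_comp (𝟙 _))
  triangle f g := LaxHom.hom_ext fun x =>
    (Category.id_comp _).trans (g.F.map_id _).symm

instance : Bicategory.Strict (Model T) where
  id_comp f := LaxHom.id_comp f
  comp_id f := LaxHom.comp_id f
  assoc f g h := LaxHom.comp_assoc f g h
  leftUnitor_eqToIso f := Iso.ext (LaxHom.hom_ext fun x =>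
    (LaxHom.eqToHom_app_eq (LaxHom.id_comp f) x rfl).symm)
  rightUnitor_eqToIso f := Iso.ext (LaxHom.hom_ext fun x =>
    (LaxHom.eqToHom_app_eq (LaxHom.comp_id f) x rfl).symm)
  associator_eqToIso f g h := Iso.ext (LaxHom.hom_ext fun x =>
    (LaxHom.eqToHom_app_eq (LaxHom.comp_assoc f g h) x rfl).symm)

/-- The terminal model. -/
def terminalModel (T : LawvereTwoTheory.{w, u}) : Model T where
  C := Discrete PUnit.{u + 1}
  op _ _ := (Functor.const _).obj ⟨PUnit.unit⟩
  op₂ _ _ := 𝟙 _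
  op_comp _ _ _ := Functor.hext (fun _ => rfl) fun _ _ _ => heq_of_eq (Subsingleton.elim _ _)
  op_inert _ _ := Functor.hext (fun _ => rfl) fun _ _ _ => heq_of_eq (Subsingleton.elim _ _)
  op₂_id _ _ := rfl
  op₂_comp _ _ _ := (Category.id_comp _).symm
  op₂_whiskerLeft _ _ _ _ _ _ := HEq.rfl
  op₂_whiskerRight _ _ _ _ := HEq.rfl

namespace Model

variable (X : Model T) (μ : T.LaxCommutativity)

section

variable {m m' n n' : T.Ob}

theorem op_left_obj (β : m ⟶ m') (j : m'.Ix) (i : n.Ix) (N : (m.mul n).Ix → X.C) :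
    (X.op ((μ.left n).map β) (pair j i)).obj N = (X.op β j).obj fun k => N (pair k i) := by
  have h := congrArg (fun a => (X.op a j).obj N) (μ.left_col n β i)
  simpa only [op_comp_obj, op_inert_obj] using h

theorem op_right_obj (α : n ⟶ n') (j : m.Ix) (i : n'.Ix) (N : (m.mul n).Ix → X.C) :
    (X.op ((μ.right m).map α) (pair j i)).obj N = (X.op α i).obj fun k => N (pair j k) := by
  have h := congrArg (fun a => (X.op a i).obj N) (μ.right_row m α j)
  simpa only [op_comp_obj, op_inert_obj] using h

theorem op_left_map (β : m ⟶ m') (j : m'.Ix) (i : n.Ix) {N N' : (m.mul n).Ix → X.C}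
    (f : ∀ k, N k ⟶ N' k) :
    (X.op ((μ.left n).map β) (pair j i)).map f ≍ (X.op β j).map fun k => f (pair k i) := by
  have h : (X.op ((μ.left n).map β ≫ θ fun j => pair j i) j).map f ≍
      (X.op (θ (fun j => pair j i) ≫ β) j).map f := by
    rw [μ.left_col n β i]
  refine ((X.op_comp_map _ _ j f).trans (X.op_inert_map _ j _)).symm.trans
    (h.trans ((X.op_comp_map _ _ j f).trans (X.op_map_hcongr β j ?_ ?_ ?_)))
  · exact fun k => X.op_inert_obj _ k _
  · exact fun k => X.op_inert_obj _ k _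
  · exact fun k => X.op_inert_map _ k _

theorem op_right_map (α : n ⟶ n') (j : m.Ix) (i : n'.Ix) {N N' : (m.mul n).Ix → X.C}
    (f : ∀ k, N k ⟶ N' k) :
    (X.op ((μ.right m).map α) (pair j i)).map f ≍ (X.op α i).map fun k => f (pair j k) := by
  have h : (X.op ((μ.right m).map α ≫ θ fun i => pair j i) i).map f ≍
      (X.op (θ (fun i => pair j i) ≫ α) i).map f := by
    rw [μ.right_row m α j]
  refine ((X.op_comp_map _ _ i f).trans (X.op_inert_map _ i _)).symm.trans
    (h.trans ((X.op_comp_map _ _ i f).trans (X.op_map_hcongr α i ?_ ?_ ?_)))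
  · exact fun k => X.op_inert_obj _ k _
  · exact fun k => X.op_inert_obj _ k _
  · exact fun k => X.op_inert_map _ k _

theorem op₂_whiskerRight_inert {k : T.Ob} {α β : m ⟶ n} (s : α ⟶ β) {γ : n ⟶ k}
    {p : k.Ix → n.Ix} (h : γ = θ p) (i : k.Ix) (x : m.Ix → X.C) :
    (X.op₂ (s ▷ γ) i).app x ≍ (X.op₂ s (p i)).app x := by
  subst h
  exact (X.op₂_whiskerRight s _ i x).trans (X.op_inert_map p i _)

theorem op₂_whiskerLeft_inert {k : T.Ob} {γ : k ⟶ m} {α β : m ⟶ n} (s : α ⟶ β)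
    {p : m.Ix → k.Ix} (h : γ = θ p) (i : n.Ix) (x : k.Ix → X.C) :
    (X.op₂ (γ ◁ s) i).app x ≍ (X.op₂ s i).app fun j => x (p j) := by
  subst h
  exact (X.op₂_whiskerLeft _ s i x).trans
    (app_hcongr _ (funext fun j => X.op_inert_obj p j x))

theorem op₂_app_hcongr {α β : m ⟶ n} (s : α ⟶ β) {i i' : n.Ix} (hi : i = i')
    {x x' : m.Ix → X.C} (hx : ∀ k, x k = x' k) :
    (X.op₂ s i).app x ≍ (X.op₂ s i').app x' := by
  obtain rfl := funext hx
  subst hi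
  rfl

theorem op₂_left {β β' : m ⟶ m'} (s : β ⟶ β') (j : m'.Ix) (i : n.Ix)
    (N : (m.mul n).Ix → X.C) :
    (X.op₂ ((μ.left n).map₂ s) (pair j i)).app N ≍ (X.op₂ s j).app fun k => N (pair k i) := by
  obtain ⟨h, e⟩ := μ.gray_inert_right β (n := n) (n' := one) (fun _ => i)
  obtain ⟨h', e'⟩ := μ.gray_inert_right β' (n := n) (n' := one) (fun _ => i)
  have e1 := μ.gray_natural_left s (θ (fun _ => i) : n ⟶ one)
  rw [e, e'] at e1
  have e2 : (μ.right m).map (θ fun _ => i) ◁ (μ.left one).map₂ s ≍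
      (μ.left n).map₂ s ▷ (μ.right m').map (θ (fun _ => i) : n ⟶ one) :=
    (comp_eqToHom_heq _ _).symm.trans ((heq_of_eq e1).trans (eqToHom_comp_heq _ _))
  have e3 := X.op₂_hcongr h h' e2 (pair j pt) N
  have e4 (M : (m.mul one).Ix → X.C) : (X.op₂ ((μ.left one).map₂ s) (pair j pt)).app M ≍
      (X.op₂ s j).app fun k => M (pair k pt) :=
    (X.op₂_whiskerRight_inert _ rfl j M).symm.trans
      ((X.op₂_hcongr (μ.left_one β) (μ.left_one β') (μ.left_one₂ s) j M).trans
        (X.op₂_whiskerLeft_inert _ rfl j M))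
  have e5 := (X.op₂_whiskerLeft_inert _ (μ.right_inert _ _) (pair j pt) N).symm.trans
    (e3.trans (X.op₂_whiskerRight_inert _ (μ.right_inert _ _) (pair j pt) N))
  refine (X.op₂_app_hcongr _ ?_ fun _ => rfl).trans (e5.symm.trans ((e4 _).trans
    (X.op₂_app_hcongr _ rfl fun k => ?_)))
  · simp
  · simp

theorem op₂_right {α α' : n ⟶ n'} (s : α ⟶ α') (j : m.Ix) (i : n'.Ix)
    (N : (m.mul n).Ix → X.C) :
    (X.op₂ ((μ.right m).map₂ s) (pair j i)).app N ≍ (X.op₂ s i).app fun k => N (pair j k) := by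
  obtain ⟨h, e⟩ := μ.gray_inert_left (m := m) (m' := one) (fun _ => j) α
  obtain ⟨h', e'⟩ := μ.gray_inert_left (m := m) (m' := one) (fun _ => j) α'
  have e1 := μ.gray_natural_right (θ (fun _ => j) : m ⟶ one) s
  rw [e, e'] at e1
  have e2 : (μ.right m).map₂ s ▷ (μ.left n').map (θ (fun _ => j) : m ⟶ one) ≍
      (μ.left n).map (θ fun _ => j) ◁ (μ.right one).map₂ s :=
    (comp_eqToHom_heq _ _).symm.trans ((heq_of_eq e1).trans (eqToHom_comp_heq _ _))
  have e3 := X.op₂_hcongr h h' e2 (pair pt i) N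
  have e4 (M : (one.mul n).Ix → X.C) : (X.op₂ ((μ.right one).map₂ s) (pair pt i)).app M ≍
      (X.op₂ s i).app fun k => M (pair pt k) :=
    (X.op₂_whiskerRight_inert _ rfl i M).symm.trans
      ((X.op₂_hcongr (μ.right_one α) (μ.right_one α') (μ.right_one₂ s) i M).trans
        (X.op₂_whiskerLeft_inert _ rfl i M))
  have e5 := (X.op₂_whiskerRight_inert _ (μ.left_inert _ _) (pair pt i) N).symm.trans
    (e3.trans (X.op₂_whiskerLeft_inert _ (μ.left_inert _ _) (pair pt i) N))
  refine (X.op₂_app_hcongr _ ?_ fun _ => rfl).trans (e5.trans ((e4 _).trans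
    (X.op₂_app_hcongr _ rfl fun k => ?_)))
  · simp
  · simp

end

/-- The entries of a matrix, as one tuple indexed by a product. -/
def flat {D : Type*} {p m : T.Ob} (M : p.Ix → m.Ix → D) (k : (p.mul m).Ix) : D :=
  M (fst k) (snd k)

theorem sig_source {p q m n : T.Ob} (β : p ⟶ q) (α : m ⟶ n) (M : p.Ix → m.Ix → X.C) (j : q.Ix)
    (i : n.Ix) : (X.op ((μ.right p).map α ≫ (μ.left n).map β) (pair j i)).obj (flat M) =
      (X.op β j).obj fun l => (X.op α i).obj (M l) := by
  simp [op_comp_obj, op_left_obj, op_right_obj, flat]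

theorem sig_target {p q m n : T.Ob} (β : p ⟶ q) (α : m ⟶ n) (M : p.Ix → m.Ix → X.C) (j : q.Ix)
    (i : n.Ix) : (X.op ((μ.left m).map β ≫ (μ.right q).map α) (pair j i)).obj (flat M) =
      (X.op α i).obj fun k => (X.op β j).obj fun l => M l k := by
  simp [op_comp_obj, op_left_obj, op_right_obj, flat]

/-- The comparison of the two ways of applying the operations `α` and `β` to the rows and to the
columns of a matrix `M` of objects of `X`: the image in `X` of the Gray cell of `β` and `α`. -/
def sig {p q m n : T.Ob} (β : p ⟶ q) (α : m ⟶ n) (M : p.Ix → m.Ix → X.C) (j : q.Ix)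
    (i : n.Ix) : ((X.op β j).obj fun l => (X.op α i).obj (M l)) ⟶
      (X.op α i).obj fun k => (X.op β j).obj fun l => M l k :=
  eqToHom (X.sig_source μ β α M j i).symm ≫ (X.op₂ (μ.gray β α) (pair j i)).app (flat M) ≫
    eqToHom (X.sig_target μ β α M j i)

section

variable {p q r m n k : T.Ob}

theorem sig_heq (β : p ⟶ q) (α : m ⟶ n) (M : p.Ix → m.Ix → X.C) (j : q.Ix) (i : n.Ix) :
    X.sig μ β α M j i ≍ (X.op₂ (μ.gray β α) (pair j i)).app (flat M) :=
  (eqToHom_comp_heq _ _).trans (comp_eqToHom_heq _ _)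

theorem entry_hcongr {M M' : p.Ix → m.Ix → X.C} (f : ∀ l k, M l k ⟶ M' l k) {l l' : p.Ix}
    {k k' : m.Ix} (hl : l = l') (hk : k = k') : f l k ≍ f l' k' := by
  subst hl hk; rfl

theorem sig_source_map (β : p ⟶ q) (α : m ⟶ n) {M M' : p.Ix → m.Ix → X.C}
    (f : ∀ l k, M l k ⟶ M' l k) (j : q.Ix) (i : n.Ix) :
    (X.op ((μ.right p).map α ≫ (μ.left n).map β) (pair j i)).map
        (X := flat M) (Y := flat M') (fun k => f (fst k) (snd k)) ≍
      (X.op β j).map fun l => (X.op α i).map (f l) := by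
  refine (X.op_comp_map _ _ _ _).trans ((X.op_left_map μ β j i _).trans
    (X.op_map_hcongr β j ?_ ?_ fun l => (X.op_right_map μ α l i _).trans
      (X.op_map_hcongr α i ?_ ?_ ?_)))
  all_goals intro l
  · simp [op_right_obj, flat]
  · simp [op_right_obj, flat]
  · simp [flat]
  · simp [flat]
  · exact X.entry_hcongr f (fst_pair _ _) (snd_pair _ _)

theorem sig_target_map (β : p ⟶ q) (α : m ⟶ n) {M M' : p.Ix → m.Ix → X.C}
    (f : ∀ l k, M l k ⟶ M' l k) (j : q.Ix) (i : n.Ix) :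
    (X.op ((μ.left m).map β ≫ (μ.right q).map α) (pair j i)).map
        (X := flat M) (Y := flat M') (fun k => f (fst k) (snd k)) ≍
      (X.op α i).map fun k => (X.op β j).map fun l => f l k := by
  refine (X.op_comp_map _ _ _ _).trans ((X.op_right_map μ α j i _).trans
    (X.op_map_hcongr α i ?_ ?_ fun l => (X.op_left_map μ β j l _).trans
      (X.op_map_hcongr β j ?_ ?_ ?_)))
  all_goals intro l
  · simp [op_left_obj, flat]
  · simp [op_left_obj, flat]
  · simp [flat]
  · simp [flat]
  · exact X.entry_hcongr f (fst_pair _ _) (snd_pair _ _)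

theorem sig_natural (β : p ⟶ q) (α : m ⟶ n) {M M' : p.Ix → m.Ix → X.C}
    (f : ∀ l k, M l k ⟶ M' l k) (j : q.Ix) (i : n.Ix) :
    X.sig μ β α M j i ≫ (X.op α i).map (fun k => (X.op β j).map fun l => f l k) =
      (X.op β j).map (fun l => (X.op α i).map (f l)) ≫ X.sig μ β α M' j i := by
  have h := X.op₂_naturality (μ.gray β α) (pair j i) (x := flat M) (y := flat M')
    fun k => f (fst k) (snd k)
  have hs := X.sig_source μ β α
  have ht := X.sig_target μ β α
  exact eq_of_heq ((comp_hcongr (hs M j i).symm (ht M j i).symm (ht M' j i).symm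
      (X.sig_heq μ β α M j i) (X.sig_target_map μ β α f j i).symm).trans
    ((heq_of_eq h.symm).trans (comp_hcongr (hs M j i) (hs M' j i) (ht M' j i)
      (X.sig_source_map μ β α f j i) (X.sig_heq μ β α M' j i).symm)))

theorem sig_op₂_left {β β' : p ⟶ q} (s : β ⟶ β') (α : m ⟶ n) (M : p.Ix → m.Ix → X.C)
    (j : q.Ix) (i : n.Ix) :
    X.sig μ β α M j i ≫ (X.op α i).map (fun k => (X.op₂ s j).app fun l => M l k) =
      (X.op₂ s j).app (fun l => (X.op α i).obj (M l)) ≫ X.sig μ β' α M j i := by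
  have h := congrArg (fun t => (X.op₂ t (pair j i)).app (flat M)) (μ.gray_natural_left s α)
  simp only [op₂_comp_app] at h
  have hs (β : p ⟶ q) := X.sig_source μ β α M j i
  have ht (β : p ⟶ q) := X.sig_target μ β α M j i
  refine eq_of_heq ((comp_hcongr (hs β).symm (ht β).symm (ht β').symm
      (X.sig_heq μ β α M j i) ?_).trans
    ((heq_of_eq h.symm).trans (comp_hcongr (hs β) (hs β') (ht β')
      ?_ (X.sig_heq μ β' α M j i).symm)))
  · refine ((X.op₂_whiskerRight _ _ _ _).trans ((X.op_right_map μ α j i _).trans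
      (X.op_map_hcongr α i ?_ ?_ fun k => (X.op₂_left μ s j k _).trans
        (X.op₂_app_hcongr s rfl ?_)))).symm
    all_goals intro k
    · simp [op_left_obj, flat]
    · simp [op_left_obj, flat]
    · simp [flat]
  · refine (X.op₂_whiskerLeft _ _ _ _).trans ((X.op₂_left μ s j i _).trans
      (X.op₂_app_hcongr s rfl fun k => ?_))
    simp [op_right_obj, flat]

theorem sig_op₂_right (β : p ⟶ q) {α α' : m ⟶ n} (s : α ⟶ α') (M : p.Ix → m.Ix → X.C)
    (j : q.Ix) (i : n.Ix) :
    X.sig μ β α M j i ≫ (X.op₂ s i).app (fun k => (X.op β j).obj fun l => M l k) =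
      (X.op β j).map (fun l => (X.op₂ s i).app (M l)) ≫ X.sig μ β α' M j i := by
  have h := congrArg (fun t => (X.op₂ t (pair j i)).app (flat M)) (μ.gray_natural_right β s)
  simp only [op₂_comp_app] at h
  have hs (α : m ⟶ n) := X.sig_source μ β α M j i
  have ht (α : m ⟶ n) := X.sig_target μ β α M j i
  refine eq_of_heq ((comp_hcongr (hs α).symm (ht α).symm (ht α').symm
      (X.sig_heq μ β α M j i) ?_).trans
    ((heq_of_eq h.symm).trans (comp_hcongr (hs α) (hs α') (ht α')
      ?_ (X.sig_heq μ β α' M j i).symm)))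
  · refine ((X.op₂_whiskerLeft _ _ _ _).trans ((X.op₂_right μ s j i _).trans
      (X.op₂_app_hcongr s rfl fun k => ?_))).symm
    simp [op_left_obj, flat]
  · refine (X.op₂_whiskerRight _ _ _ _).trans ((X.op_left_map μ β j i _).trans
      (X.op_map_hcongr β j ?_ ?_ fun k => (X.op₂_right μ s k i _).trans
        (X.op₂_app_hcongr s rfl ?_)))
    all_goals intro k
    · simp [op_right_obj, flat]
    · simp [op_right_obj, flat]
    · simp [flat]

theorem sig_inert_left (a : q.Ix → p.Ix) (α : m ⟶ n) (M : p.Ix → m.Ix → X.C) (j : q.Ix)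
    (i : n.Ix) : X.sig μ (θ a) α M j i ≍ 𝟙 ((X.op α i).obj (M (a j))) := by
  obtain ⟨h, e⟩ := μ.gray_inert_left a α
  refine (X.sig_heq μ _ α M j i).trans ?_
  rw [e]
  refine (X.op₂_eqToHom_app h _ _).trans (id_hcongr ?_)
  rw [sig_source, op_inert_obj]

theorem sig_inert_right (β : p ⟶ q) (a : n.Ix → m.Ix) (M : p.Ix → m.Ix → X.C) (j : q.Ix)
    (i : n.Ix) : X.sig μ β (θ a) M j i ≍ 𝟙 ((X.op β j).obj fun l => M l (a i)) := by
  obtain ⟨h, e⟩ := μ.gray_inert_right β a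
  refine (X.sig_heq μ β _ M j i).trans ?_
  rw [e]
  refine (X.op₂_eqToHom_app h _ _).trans (id_hcongr ?_)
  rw [sig_source]
  simp only [op_inert_obj]

theorem op₂_paste {a₀ a₁ a₂ a₃ a₄ a₅ : m ⟶ n} (h₁ : a₀ = a₁) (A : a₁ ⟶ a₂) (h₂ : a₂ = a₃)
    (B : a₃ ⟶ a₄) (h₃ : a₄ = a₅) (i : n.Ix) (x : m.Ix → X.C) {P Q R : X.C} {f : P ⟶ Q}
    {g : Q ⟶ R} (hP : (X.op a₁ i).obj x = P) (hQ : (X.op a₂ i).obj x = Q)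
    (hR : (X.op a₄ i).obj x = R) (hf : (X.op₂ A i).app x ≍ f) (hg : (X.op₂ B i).app x ≍ g) :
    (X.op₂ (eqToHom h₁ ≫ A ≫ eqToHom h₂ ≫ B ≫ eqToHom h₃) i).app x ≍ f ≫ g := by
  subst h₁ h₂ h₃
  simp only [eqToHom_refl, Category.id_comp, Category.comp_id, op₂_comp_app]
  exact comp_hcongr hP hQ hR hf hg

theorem sig_comp_left (β : p ⟶ q) (β' : q ⟶ r) (α : m ⟶ n) (M : p.Ix → m.Ix → X.C)
    (j : r.Ix) (i : n.Ix) :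
    X.sig μ (β ≫ β') α M j i ≍
      (X.op β' j).map (fun l => X.sig μ β α M l i) ≫
        X.sig μ β' α (fun l k => (X.op β l).obj fun l' => M l' k) j i := by
  refine (X.sig_heq μ _ α M j i).trans ?_
  rw [μ.gray_comp_left, Strict.associator_eqToIso]
  have hM : (fun k => (X.op ((μ.left m).map β) k).obj (flat M)) =
      flat fun l k => (X.op β l).obj fun l' => M l' k := by
    funext k
    rw [← pair_fst_snd k, op_left_obj]
    simp [flat]
  refine X.op₂_paste _ _ (Category.assoc _ _ _) _ _ _ _ ?_ ?_ ?_ ?_ ?_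
  · simp [op_comp_obj, op_left_obj, op_right_obj, flat]
  · simp [op_comp_obj, op_left_obj, op_right_obj, flat]
  · simp [op_comp_obj, op_left_obj, op_right_obj, flat]
  · exact (X.op₂_whiskerRight _ _ _ _).trans ((X.op_left_map μ β' j i _).trans
      (X.op_map_hcongr β' j (fun l => X.sig_source μ β α M l i)
        (fun l => X.sig_target μ β α M l i) fun l => (X.sig_heq μ β α M l i).symm))
  · refine (X.op₂_whiskerLeft _ _ _ _).trans ((app_hcongr _ hM).trans (X.sig_heq μ _ _ _ _ _).symm)

theorem sig_comp_right (β : p ⟶ q) (α : m ⟶ n) (α' : n ⟶ k) (M : p.Ix → m.Ix → X.C)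
    (j : q.Ix) (i : k.Ix) :
    X.sig μ β (α ≫ α') M j i ≍
      X.sig μ β α' (fun l k => (X.op α k).obj (M l)) j i ≫
        (X.op α' i).map fun k => X.sig μ β α M j k := by
  refine (X.sig_heq μ β _ M j i).trans ?_
  rw [μ.gray_comp_right, Strict.associator_eqToIso]
  have hM : (fun l => (X.op ((μ.right p).map α) l).obj (flat M)) =
      flat fun l k => (X.op α k).obj (M l) := by
    funext l
    rw [← pair_fst_snd l, op_right_obj]
    simp [flat]
  refine X.op₂_paste _ _ (Category.assoc _ _ _).symm _ _ _ _ ?_ ?_ ?_ ?_ ?_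
  · simp [op_comp_obj, op_left_obj, op_right_obj, flat]
  · simp [op_comp_obj, op_left_obj, op_right_obj, flat]
  · simp [op_comp_obj, op_left_obj, op_right_obj, flat]
  · exact (X.op₂_whiskerLeft _ _ _ _).trans ((app_hcongr _ hM).trans
      (X.sig_heq μ _ _ _ _ _).symm)
  · exact (X.op₂_whiskerRight _ _ _ _).trans ((X.op_right_map μ α' j i _).trans
      (X.op_map_hcongr α' i (fun l => X.sig_source μ β α M j l)
        (fun l => X.sig_target μ β α M j l) fun l => (X.sig_heq μ β α M j l).symm))

end

end Model

theorem paste_eq {C : Type*} [Category C] {a b c d e b' : C} {A : a ⟶ b} {B : b ⟶ c} {D : c ⟶ d}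
    {E : d ⟶ e} {G : b ⟶ b'} {H : b' ⟶ d} {K : a ⟶ b'} (hK : K = A ≫ G)
    (h : B ≫ D = G ≫ H) : (A ≫ B) ≫ D ≫ E = K ≫ H ≫ E := by
  rw [hK, Category.assoc, Category.assoc, ← Category.assoc B, h, Category.assoc]

namespace LaxHom

variable {X Y Z : Model T} (μ : T.LaxCommutativity)

/-- The lax homomorphism obtained by applying the `i`-th component of the operation `α` of `Z` to
a tuple of lax homomorphisms into `Z`; its cells use the Gray cells. -/
def opHom {m n : T.Ob} (α : m ⟶ n) (i : n.Ix) (f : m.Ix → LaxHom Y Z) : LaxHom Y Z where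
  F := Functor.pi' (fun k => (f k).F) ⋙ Z.op α i
  cell β y j := Z.sig μ β α (fun l k => (f k).F.obj (y l)) j i ≫
    (Z.op α i).map fun k => (f k).cell β y j
  cell_naturality {p q} β y y' a j := by
    have h1 := Z.sig_natural μ β α (fun l k => (f k).F.map (a l)) j i
    have h2 : (Z.op α i).map (fun k => (Z.op β j).map fun l => (f k).F.map (a l)) ≫
        (Z.op α i).map (fun k => (f k).cell β y' j) =
      (Z.op α i).map (fun k => (f k).cell β y j) ≫
        (Z.op α i).map (fun k => (f k).F.map ((Y.op β j).map a)) := by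
      rw [← Z.op_map_comp, ← Z.op_map_comp]
      exact congrArg _ (funext fun k => (f k).cell_naturality β a j)
    refine (Category.assoc _ _ _).symm.trans ((congrArg (· ≫ _) h1.symm).trans ?_)
    refine (Category.assoc _ _ _).trans ((congrArg (_ ≫ ·) h2).trans ?_)
    exact (Category.assoc _ _ _).symm
  cell_op₂ {p q β β'} s y j := by
    have h1 := Z.sig_op₂_left μ s α (fun l k => (f k).F.obj (y l)) j i
    have h2 : (Z.op α i).map (fun k => (f k).cell β y j) ≫
        (Z.op α i).map (fun k => (f k).F.map ((Y.op₂ s j).app y)) =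
      (Z.op α i).map (fun k => (Z.op₂ s j).app fun l => (f k).F.obj (y l)) ≫
        (Z.op α i).map (fun k => (f k).cell β' y j) := by
      rw [← Z.op_map_comp, ← Z.op_map_comp]
      exact congrArg _ (funext fun k => (f k).cell_op₂ s y j)
    refine (Category.assoc _ _ _).trans ((congrArg (_ ≫ ·) h2).trans ?_)
    refine (Category.assoc _ _ _).symm.trans ((congrArg (· ≫ _) h1).trans ?_)
    exact Category.assoc _ _ _
  cell_inert p y j := by
    refine (comp_heq_left ?_ ?_ (Z.op_map_heq_id α i ?_ ?_ fun k => (f k).cell_inert p y j)).trans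
      (Z.sig_inert_left μ p α _ j i)
    · simp [Z.op_inert_obj, Y.op_inert_obj]
    · simp [Z.op_inert_obj]
    · exact fun k => Z.op_inert_obj p j _
    · intro k
      rw [Y.op_inert_obj]
  cell_comp {p q r} β β' y j := by
    have h1 : (Z.op α i).map (fun k => (f k).cell (β ≫ β') y j) ≍
        (Z.op α i).map (fun k => (Z.op β' j).map fun l => (f k).cell β y l) ≫
          (Z.op α i).map (fun k => (f k).cell β' (fun l => (Y.op β l).obj y) j) := by
      rw [← Z.op_map_comp]
      refine Z.op_map_hcongr α i ?_ ?_ fun k => (f k).cell_comp β β' y j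
      · exact fun k => Z.op_comp_obj β β' j _
      · intro k
        rw [Y.op_comp_obj]
    have h2 := Z.sig_natural μ β' α (fun l k => (f k).cell β y l) j i
    have h3 := Z.sig_comp_left μ β β' α (fun l k => (f k).F.obj (y l)) j i
    refine (comp_hcongr ?_ ?_ ?_ h3 h1).trans (heq_of_eq ?_)
    · simp [Z.op_comp_obj]
    · simp [Z.op_comp_obj]
    · simp [Y.op_comp_obj]
    · exact paste_eq (Z.op_map_comp β' j _ _) h2

/-- A tuple of modifications induces a modification between the values of an operation. -/
def opModif {m n : T.Ob} (α : m ⟶ n) (i : n.Ix) {f g : m.Ix → LaxHom Y Z}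
    (t : ∀ k, f k ⟶ g k) : opHom μ α i f ⟶ opHom μ α i g where
  app :=
    { app := fun y => (Z.op α i).map fun k => (t k).app.app y
      naturality := fun y y' a => by
        refine (Z.op_map_comp α i _ _).symm.trans (Eq.trans ?_ (Z.op_map_comp α i _ _))
        exact congrArg _ (funext fun k => (t k).app.naturality a) }
  comm {p q} β y j := by
    have h1 := Z.sig_natural μ β α (fun l k => (t k).app.app (y l)) j i
    have h2 : (Z.op α i).map (fun k => (f k).cell β y j) ≫
        (Z.op α i).map (fun k => (t k).app.app ((Y.op β j).obj y)) =
      (Z.op α i).map (fun k => (Z.op β j).map fun l => (t k).app.app (y l)) ≫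
        (Z.op α i).map (fun k => (g k).cell β y j) := by
      rw [← Z.op_map_comp, ← Z.op_map_comp]
      exact congrArg _ (funext fun k => (t k).comm β y j)
    refine (Category.assoc _ _ _).trans ((congrArg (_ ≫ ·) h2).trans ?_)
    refine (Category.assoc _ _ _).symm.trans ((congrArg (· ≫ _) h1).trans ?_)
    exact Category.assoc _ _ _

theorem opHom_hcongr {m n : T.Ob} (α : m ⟶ n) (i : n.Ix) {f g : m.Ix → LaxHom Y Z}
    (h : ∀ k, f k = g k) : opHom μ α i f = opHom μ α i g := by
  obtain rfl := funext h
  rfl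

theorem opHom_comp {m n k : T.Ob} (α : m ⟶ n) (α' : n ⟶ k) (i : k.Ix) (f : m.Ix → LaxHom Y Z) :
    opHom μ (α ≫ α') i f = opHom μ α' i fun j => opHom μ α j f := by
  refine hext (fun y => ?_) (fun a => ?_) fun {p q} β y j => ?_
  · exact Z.op_comp_obj α α' i _
  · exact Z.op_comp_map α α' i _
  · refine (comp_hcongr ?_ ?_ ?_ (Z.sig_comp_right μ β α α' (fun l k => (f k).F.obj (y l)) j i)
      (Z.op_comp_map α α' i _)).trans (heq_of_eq ?_)
    · simp [Z.op_comp_obj]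
    · simp [Z.op_comp_obj]
    · simp [Z.op_comp_obj]
    · refine (Category.assoc _ _ _).trans (congrArg (_ ≫ ·) ?_)
      exact (Z.op_map_comp α' i _ _).symm

theorem opHom_inert {m n : T.Ob} (p : n.Ix → m.Ix) (i : n.Ix) (f : m.Ix → LaxHom Y Z) :
    opHom μ (θ p) i f = f (p i) := by
  refine hext (fun y => ?_) (fun a => ?_) fun {q r} β y j => ?_
  · exact Z.op_inert_obj p i _
  · exact Z.op_inert_map p i _
  · refine (comp_heq_right ?_ ?_ (Z.sig_inert_right μ β p _ j i)).trans (Z.op_inert_map p i _)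
    · simp [Z.op_inert_obj]
    · simp [Z.op_inert_obj]

/-- A 2-cell of the theory induces a modification between the corresponding operations. -/
def op₂Modif {m n : T.Ob} {α α' : m ⟶ n} (s : α ⟶ α') (i : n.Ix) (f : m.Ix → LaxHom Y Z) :
    opHom μ α i f ⟶ opHom μ α' i f where
  app := Functor.whiskerLeft (Functor.pi' fun k => (f k).F) (Z.op₂ s i)
  comm {p q} β y j := by
    have h1 := Z.sig_op₂_right μ β s (fun l k => (f k).F.obj (y l)) j i
    have h2 := Z.op₂_naturality s i (fun k => (f k).cell β y j)
    refine (Category.assoc _ _ _).trans ((congrArg (_ ≫ ·) h2).trans ?_)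
    refine (Category.assoc _ _ _).symm.trans ((congrArg (· ≫ _) h1).trans ?_)
    exact Category.assoc _ _ _

end LaxHom

/-- The internal hom of models: the category of lax homomorphisms `Y ⟶ Z` and modifications, where
an operation `α` acts by postcomposition with the lift of the operation `α` of `Z` to a lax
homomorphism (whose cells are given by the Gray cells). -/
def internalHom (μ : T.LaxCommutativity) (Y Z : Model T) : Model T where
  C := LaxHom Y Z
  op α i :=
    { obj := fun f => LaxHom.opHom μ α i f
      map := fun t => LaxHom.opModif μ α i t
      map_id := fun f => LaxHom.hom_ext fun y => Z.op_map_id α i _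
      map_comp := fun s t => LaxHom.hom_ext fun y => Z.op_map_comp α i _ _ }
  op₂ s i :=
    { app := fun f => LaxHom.op₂Modif μ s i f
      naturality := fun f g t => LaxHom.hom_ext fun y => Z.op₂_naturality s i _ }
  op_comp α β i := Functor.hext (fun f => LaxHom.opHom_comp μ α β i f) fun f g t =>
    LaxHom.hom_hext (LaxHom.opHom_comp μ α β i f) (LaxHom.opHom_comp μ α β i g)
      fun y => Z.op_comp_map α β i _
  op_inert p i := Functor.hext (fun f => LaxHom.opHom_inert μ p i f) fun f g t =>
    LaxHom.hom_hext (LaxHom.opHom_inert μ p i f) (LaxHom.opHom_inert μ p i g)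
      fun y => Z.op_inert_map p i _
  op₂_id α i := NatTrans.ext (funext fun f => LaxHom.hom_ext fun y =>
    congrArg (fun t => t.app fun k => (f k).F.obj y) (Z.op₂_id α i))
  op₂_comp s t i := NatTrans.ext (funext fun f => LaxHom.hom_ext fun y =>
    congrArg (fun t => t.app fun k => (f k).F.obj y) (Z.op₂_comp s t i))
  op₂_whiskerLeft α _ _ s i f := LaxHom.hom_hext (LaxHom.opHom_comp μ _ _ i f)
    (LaxHom.opHom_comp μ _ _ i f) fun y => Z.op₂_whiskerLeft α s i _
  op₂_whiskerRight s γ i f := LaxHom.hom_hext (LaxHom.opHom_comp μ _ _ i f)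
    (LaxHom.opHom_comp μ _ _ i f) fun y => Z.op₂_whiskerRight s γ i _

theorem paste_eq₂ {C : Type*} [Category C] {a b c d e f v z : C} {S : a ⟶ b} {K : b ⟶ c}
    {L : c ⟶ d} {A : a ⟶ e} {B : e ⟶ f} {D : f ⟶ d} {P : b ⟶ v} {Q : v ⟶ c} {L' : v ⟶ z}
    {R : z ⟶ d} {E : f ⟶ z} (h3 : K = P ≫ Q) (h2 : Q ≫ L = L' ≫ R)
    (h1 : S ≫ P ≫ L' = (A ≫ B) ≫ E) (h4 : D = E ≫ R) : (S ≫ K) ≫ L = A ≫ B ≫ D := by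
  rw [h3, h4, Category.assoc, Category.assoc, h2]
  simpa using congrArg (· ≫ R) h1

namespace LaxHom

variable {X Y Z : Model T} (μ : T.LaxCommutativity)

theorem cell_congr (g : LaxHom X Y) {m n : T.Ob} {α β : m ⟶ n} (h : α = β) (x : m.Ix → X.C)
    (i : n.Ix) : g.cell α x i ≍ g.cell β x i := by
  subst h; rfl

theorem cell_hcongr (g : LaxHom X Y) {m n : T.Ob} (α : m ⟶ n) {x x' : m.Ix → X.C}
    (h : ∀ k, x k = x' k) (i : n.Ix) : g.cell α x i ≍ g.cell α x' i := by
  obtain rfl := funext h; rfl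

theorem cell_comp_inert (g : LaxHom X Y) {m n k : T.Ob} (α : m ⟶ n) (p : k.Ix → n.Ix)
    (x : m.Ix → X.C) (i : k.Ix) : g.cell (α ≫ θ p) x i ≍ g.cell α x (p i) := by
  refine (g.cell_comp α (θ p) x i).trans ?_
  refine (comp_heq_left ?_ ?_ (g.cell_inert p _ i)).trans (Y.op_inert_map p i _)
  · rw [Y.op_inert_obj, X.op_inert_obj]
  · rw [Y.op_inert_obj]

theorem cell_inert_comp (g : LaxHom X Y) {m n k : T.Ob} (p : n.Ix → m.Ix) (β : n ⟶ k)
    (x : m.Ix → X.C) (i : k.Ix) : g.cell (θ p ≫ β) x i ≍ g.cell β (fun j => x (p j)) i := by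
  refine (g.cell_comp (θ p) β x i).trans ?_
  refine (comp_heq_right ?_ ?_ (Y.op_map_heq_id β i ?_ ?_ fun k => g.cell_inert p x k)).trans ?_
  · simp [X.op_inert_obj, Y.op_inert_obj]
  · simp [Y.op_inert_obj]
  · exact fun k => Y.op_inert_obj p k _
  · intro k
    rw [X.op_inert_obj]
  · exact g.cell_hcongr β (fun k => X.op_inert_obj p k x) i

theorem cell_left (g : LaxHom X Y) {m m' n : T.Ob} (β : m ⟶ m') (j : m'.Ix) (i : n.Ix)
    (N : (m.mul n).Ix → X.C) :
    g.cell ((μ.left n).map β) N (pair j i) ≍ g.cell β (fun k => N (pair k i)) j :=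
  (g.cell_comp_inert _ _ N j).symm.trans
    ((g.cell_congr (μ.left_col n β i) N j).trans (g.cell_inert_comp _ β N j))

theorem cell_right (g : LaxHom X Y) {m n n' : T.Ob} (α : n ⟶ n') (j : m.Ix) (i : n'.Ix)
    (N : (m.mul n).Ix → X.C) :
    g.cell ((μ.right m).map α) N (pair j i) ≍ g.cell α (fun k => N (pair j k)) i :=
  (g.cell_comp_inert _ _ N i).symm.trans
    ((g.cell_congr (μ.right_row m α j) N i).trans (g.cell_inert_comp _ α N i))

/-- The cells of a lax homomorphism are compatible with the Gray cells. -/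
theorem cell_sig (g : LaxHom X Y) {p q m n : T.Ob} (β : p ⟶ q) (α : m ⟶ n)
    (M : p.Ix → m.Ix → X.C) (j : q.Ix) (i : n.Ix) :
    Y.sig μ β α (fun l k => g.F.obj (M l k)) j i ≫
        (Y.op α i).map (fun k => g.cell β (fun l => M l k) j) ≫
        g.cell α (fun k => (X.op β j).obj fun l => M l k) i =
      ((Y.op β j).map (fun l => g.cell α (M l) i) ≫
        g.cell β (fun l => (X.op α i).obj (M l)) j) ≫ g.F.map (X.sig μ β α M j i) := by
  have h := g.cell_op₂ (μ.gray β α) (Model.flat M) (pair j i)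
  have hs := X.sig_source μ β α M j i
  have ht := X.sig_target μ β α M j i
  have h₁ : g.cell ((μ.right p).map α ≫ (μ.left n).map β) (Model.flat M) (pair j i) ≍
      (Y.op β j).map (fun l => g.cell α (M l) i) ≫
        g.cell β (fun l => (X.op α i).obj (M l)) j := by
    refine (g.cell_comp _ _ _ _).trans (comp_hcongr ?_ ?_ ?_
      ((Y.op_left_map μ β j i _).trans (Y.op_map_hcongr β j ?_ ?_ fun l =>
        (g.cell_right μ α l i _).trans (g.cell_hcongr α ?_ i)))
      ((g.cell_left μ β j i _).trans (g.cell_hcongr β ?_ j)))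
    · simp [Y.op_left_obj, Y.op_right_obj, Model.flat]
    · simp [Y.op_left_obj, X.op_right_obj, Model.flat]
    · simp [X.op_left_obj, X.op_right_obj, Model.flat]
    all_goals intro k
    · simp [Y.op_right_obj, Model.flat]
    · simp [X.op_right_obj, Model.flat]
    · simp [Model.flat]
    · simp [X.op_right_obj, Model.flat]
  have h₂ : g.cell ((μ.left m).map β ≫ (μ.right q).map α) (Model.flat M) (pair j i) ≍
      (Y.op α i).map (fun k => g.cell β (fun l => M l k) j) ≫
        g.cell α (fun k => (X.op β j).obj fun l => M l k) i := by
    refine (g.cell_comp _ _ _ _).trans (comp_hcongr ?_ ?_ ?_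
      ((Y.op_right_map μ α j i _).trans (Y.op_map_hcongr α i ?_ ?_ fun l =>
        (g.cell_left μ β j l _).trans (g.cell_hcongr β ?_ j)))
      ((g.cell_right μ α j i _).trans (g.cell_hcongr α ?_ i)))
    · simp [Y.op_left_obj, Y.op_right_obj, Model.flat]
    · simp [Y.op_right_obj, X.op_left_obj, Model.flat]
    · simp [X.op_left_obj, X.op_right_obj, Model.flat]
    all_goals intro k
    · simp [Y.op_left_obj, Model.flat]
    · simp [X.op_left_obj, Model.flat]
    · simp [Model.flat]
    · simp [X.op_left_obj, Model.flat]
  have hs' := Y.sig_source μ β α (fun l k => g.F.obj (M l k)) j i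
  have ht' := Y.sig_target μ β α (fun l k => g.F.obj (M l k)) j i
  exact eq_of_heq ((comp_hcongr hs'.symm ht'.symm (congrArg g.F.obj ht.symm)
      (Y.sig_heq μ β α _ j i) h₂.symm).trans ((heq_of_eq h.symm).trans
    (comp_hcongr hs' (congrArg g.F.obj hs) (congrArg g.F.obj ht) h₁
      (map_hcongr g.F hs ht (X.sig_heq μ β α M j i).symm))))

/-- The cell of `g`, as a modification from the operation `α` applied to a tuple of composites
with `g` to the composite with `g` of the operation `α`. -/
def cellModif (g : LaxHom X Z) {m n : T.Ob} (α : m ⟶ n) (i : n.Ix) (f : m.Ix → LaxHom Y X) :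
    opHom μ α i (fun k => comp (f k) g) ⟶ comp (opHom μ α i f) g where
  app :=
    { app := fun y => g.cell α (fun k => (f k).F.obj y) i
      naturality := fun y y' a => g.cell_naturality α (fun k => (f k).F.map a) i }
  comm {p q} β y j := by
    have h1 := g.cell_sig μ β α (fun l k => (f k).F.obj (y l)) j i
    have h2 := g.cell_naturality α (fun k => (f k).cell β y j) i
    have h3 := Z.op_map_comp α i (fun k => g.cell β (fun l => (f k).F.obj (y l)) j)
      (fun k => g.F.map ((f k).cell β y j))
    have h4 := g.F.map_comp (X.sig μ β α (fun l k => (f k).F.obj (y l)) j i)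
      ((X.op α i).map fun k => (f k).cell β y j)
    exact paste_eq₂ h3 h2 h1 h4

end LaxHom

/-- The lax homomorphism of internal homs given by postcomposition with a lax homomorphism `g`; its
cells are given by those of `g`. -/
def internalMap (μ : T.LaxCommutativity) (Y : Model T) {X Z : Model T} (g : LaxHom X Z) :
    LaxHom (internalHom μ Y X) (internalHom μ Y Z) where
  F :=
    { obj := fun f => LaxHom.comp f g
      map := fun t => LaxHom.whiskerR t g
      map_id := fun f => LaxHom.hom_ext fun y => g.F.map_id _
      map_comp := fun s t => LaxHom.hom_ext fun y => g.F.map_comp _ _ }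
  cell α f i := LaxHom.cellModif μ g α i f
  cell_naturality α f f' t i := LaxHom.hom_ext fun y => g.cell_naturality α _ i
  cell_op₂ s f i := LaxHom.hom_ext fun y => g.cell_op₂ s _ i
  cell_inert p f i := LaxHom.hom_hext (LaxHom.opHom_inert μ p i _)
    (congrArg (fun h => LaxHom.comp h g) (LaxHom.opHom_inert μ p i f)) fun y => g.cell_inert p _ i
  cell_comp α β f i := LaxHom.hom_hext (LaxHom.opHom_comp μ α β i _)
    (congrArg (fun h => LaxHom.comp h g) (LaxHom.opHom_comp μ α β i f))
    fun y => g.cell_comp α β _ i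

/-- The internal hom is functorial for modifications in its second variable. -/
def internalMap₂ (μ : T.LaxCommutativity) (Y : Model T) {X Z : Model T} {g g' : LaxHom X Z}
    (t : g ⟶ g') : internalMap μ Y g ⟶ internalMap μ Y g' where
  app :=
    { app := fun f => LaxHom.whiskerL f t
      naturality := fun f f' s => LaxHom.hom_ext fun y => t.app.naturality (s.app.app y) }
  comm α f i := LaxHom.hom_ext fun y => t.comm α (fun k => (f k).F.obj y) i

theorem internalMap_id (μ : T.LaxCommutativity) (Y X : Model T) :
    internalMap μ Y (LaxHom.idHom X) = LaxHom.idHom (internalHom μ Y X) :=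
  LaxHom.hext (fun f => LaxHom.comp_id f)
    (fun t => LaxHom.hom_hext (LaxHom.comp_id _) (LaxHom.comp_id _) fun y => HEq.rfl)
    fun α f i => LaxHom.hom_hext
      (LaxHom.opHom_hcongr μ α i fun k => LaxHom.comp_id (f k)) (LaxHom.comp_id _)
      fun y => HEq.rfl

theorem internalMap_comp (μ : T.LaxCommutativity) (Y : Model T) {X Z W : Model T}
    (g : LaxHom X Z) (h : LaxHom Z W) :
    internalMap μ Y (LaxHom.comp g h) =
      LaxHom.comp (internalMap μ Y g) (internalMap μ Y h) :=
  LaxHom.hext (fun f => (LaxHom.comp_assoc f g h).symm)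
    (fun t => LaxHom.hom_hext (LaxHom.comp_assoc _ g h).symm (LaxHom.comp_assoc _ g h).symm
      fun y => HEq.rfl)
    fun α f i => LaxHom.hom_hext
      (LaxHom.opHom_hcongr μ α i fun k => (LaxHom.comp_assoc (f k) g h).symm)
      (LaxHom.comp_assoc _ g h).symm fun y => HEq.rfl

/-- The endo-2-functor `IntAlg` of the 2-category of models and lax homomorphisms, sending `X` to
the internal hom out of the terminal model into `X`, and acting on lax homomorphisms and on
modifications by postcomposition. -/
def intAlg (μ : T.LaxCommutativity) : StrictPseudofunctor (Model T) (Model T) :=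
  StrictPseudofunctor.mk''
    { obj := fun X => internalHom μ (terminalModel T) X
      map := fun g => internalMap μ (terminalModel T) g
      map₂ := fun t => internalMap₂ μ (terminalModel T) t
      map₂_id := fun g => LaxHom.hom_ext fun f => LaxHom.hom_ext fun y => rfl
      map₂_comp := fun s t => LaxHom.hom_ext fun f => LaxHom.hom_ext fun y => rfl
      map_id := fun X => internalMap_id μ (terminalModel T) X
      map_comp := fun g h => internalMap_comp μ (terminalModel T) g h
      map₂_whisker_left := fun g h h' t => by
        refine eq_of_heq (HEq.trans ?_
          ((eqToHom_comp_heq _ _).trans (comp_eqToHom_heq _ _)).symm)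
        exact LaxHom.hom_hext (internalMap_comp μ _ g h) (internalMap_comp μ _ g h')
          fun f => LaxHom.hom_hext (LaxHom.comp_assoc f g h).symm
            (LaxHom.comp_assoc f g h').symm fun y => HEq.rfl
      map₂_whisker_right := fun {X Z W g g'} t h => by
        refine eq_of_heq (HEq.trans ?_
          ((eqToHom_comp_heq _ _).trans (comp_eqToHom_heq _ _)).symm)
        exact LaxHom.hom_hext (internalMap_comp μ _ g h) (internalMap_comp μ _ g' h)
          fun f => LaxHom.hom_hext (LaxHom.comp_assoc f g h).symm
            (LaxHom.comp_assoc f g' h).symm fun y => HEq.rfl }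

/-- The evaluation of internal algebras at the unique object of the terminal model, a strict
homomorphism `IntAlg X ⟶ X`. -/
def intAlgEval (μ : T.LaxCommutativity) (X : Model T) : (intAlg μ).obj X ⟶ X where
  F :=
    { obj := fun f => (LaxHom.F f).obj ⟨PUnit.unit⟩
      map := fun t => (LaxHom.Modif.app t).app ⟨PUnit.unit⟩
      map_id := fun f => rfl
      map_comp := fun s t => rfl }
  cell α f i := 𝟙 _
  cell_naturality α f f' t i := (Category.comp_id _).trans (Category.id_comp _).symm
  cell_op₂ s f i := (Category.id_comp _).trans (Category.comp_id _).symm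
  cell_inert p f i := id_hcongr (X.op_inert_obj p i _)
  cell_comp α β f i := by
    refine (id_hcongr (X.op_comp_obj α β i _)).trans (heq_of_eq ?_)
    exact ((congrArg (· ≫ 𝟙 _) (X.op_map_id β i _)).trans (Category.id_comp _)).symm

/-- A 2-comonad structure on an endo-2-functor `Q` of a strict 2-category. -/
structure TwoComonad {B : Type*} [Bicategory B] [Bicategory.Strict B]
    (Q : StrictPseudofunctor B B) where
  /-- The counit. -/
  counit (X : B) : Q.obj X ⟶ X
  /-- The comultiplication. -/
  comult (X : B) : Q.obj X ⟶ Q.obj (Q.obj X)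
  counit_natural {X Y : B} (f : X ⟶ Y) : Q.map f ≫ counit Y = counit X ≫ f
  counit_natural₂ {X Y : B} {f g : X ⟶ Y} (η : f ⟶ g) : Q.map₂ η ▷ counit Y ≍ counit X ◁ η
  comult_natural {X Y : B} (f : X ⟶ Y) : Q.map f ≫ comult Y = comult X ≫ Q.map (Q.map f)
  comult_natural₂ {X Y : B} {f g : X ⟶ Y} (η : f ⟶ g) :
    Q.map₂ η ▷ comult Y ≍ comult X ◁ Q.map₂ (Q.map₂ η)
  counit_left (X : B) : comult X ≫ counit (Q.obj X) = 𝟙 (Q.obj X)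
  counit_right (X : B) : comult X ≫ Q.map (counit X) = 𝟙 (Q.obj X)
  coassoc (X : B) : comult X ≫ comult (Q.obj X) = comult X ≫ Q.map (comult X)

/-- A 2-comonad is idempotent if its comultiplication is an isomorphism. -/
def TwoComonad.IsIdempotent {B : Type*} [Bicategory B] [Bicategory.Strict B]
    {Q : StrictPseudofunctor B B} (W : TwoComonad Q) : Prop :=
  ∀ X : B, ∃ g : Q.obj (Q.obj X) ⟶ Q.obj X, W.comult X ≫ g = 𝟙 _ ∧ g ≫ W.comult X = 𝟙 _

namespace LawvereTwoTheory

/-- The smallest class of 1-cells with target `1` that contains the identity of `1` and the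
1-cells in `B`, and is closed under operadic composition `α ∘ (β₁ × ⋯ × βₙ)`. -/
inductive OperadicClosure (B : ∀ n : T.Ob, (n ⟶ one) → Prop) : ∀ n : T.Ob, (n ⟶ one) → Prop
  | id : OperadicClosure B one (𝟙 one)
  | of {n : T.Ob} (α : n ⟶ one) : B n α → OperadicClosure B n α
  | comp {n : T.Ob} (k : n.Ix → T.Ob) (α : n ⟶ one) (β : ∀ i, k i ⟶ one) (γ : Ob.sum k ⟶ n) :
      (∀ i, γ ≫ proj i = θ (incl k i) ≫ β i) → OperadicClosure B n α →
      (∀ i, OperadicClosure B (k i) (β i)) → OperadicClosure B (Ob.sum k) (γ ≫ α)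

/-- A basis of 1-cells: a class of non-inert 1-cells with target `1` such that every 1-cell with
target `1` is an inert 1-cell followed by an operadic composite of members of the class. -/
def IsBasis (B : ∀ n : T.Ob, (n ⟶ one) → Prop) : Prop :=
  (∀ (n : T.Ob) (α : n ⟶ one), B n α → ∀ p : (one : T.Ob).Ix → n.Ix, α ≠ θ p) ∧
    ∀ (m : T.Ob) (γ : m ⟶ one), ∃ (n : T.Ob) (p : n.Ix → m.Ix) (α : n ⟶ one),
      OperadicClosure B n α ∧ γ = θ p ≫ α

/-- `w` is the 1-cell `1 ⟶ n` with `k`-th component the identity and all the other components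
given by the nullary operation `u`. -/
def IsUnitInsertion (u : (zero : T.Ob) ⟶ one) {n : T.Ob} (k : n.Ix) (w : one ⟶ n) : Prop :=
  ∀ i : n.Ix, w ≫ proj i = if i = k then 𝟙 one else θ (fun _ => pt) ≫ u

/-- The operation `α` is unital: there is a nullary operation `u` such that inserting `u` in all
places but one gives an operation isomorphic to the identity. -/
def IsUnital {n : T.Ob} (α : n ⟶ one) : Prop :=
  ∃ u : (zero : T.Ob) ⟶ one, ∀ k : n.Ix, ∃ w : one ⟶ n,
    IsUnitInsertion u k w ∧ Nonempty (𝟙 one ≅ w ≫ α)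

/-- The Eckmann-Hilton property of a lax commutative Lawvere 2-theory: for some basis `B`, there
are no 1-cells `1 ⟶ 1` in `B`, the members of `B` of arity at least two are unital, the Gray cell of
each member of `B` with itself is invertible, and so is the Gray cell of any two nullary
operations. -/
def LaxCommutativity.IsEckmannHilton (μ : T.LaxCommutativity) : Prop :=
  ∃ B : ∀ n : T.Ob, (n ⟶ one) → Prop, IsBasis B ∧
    (∀ α : one ⟶ one, ¬ B one α) ∧
    (∀ (n : T.Ob) (α : n ⟶ one), B n α → 2 ≤ n.card → IsUnital α) ∧
    (∀ (n : T.Ob) (α : n ⟶ one), B n α → IsIso (μ.gray α α)) ∧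
    ∀ u v : zero ⟶ one, IsIso (μ.gray u v)

end LawvereTwoTheory

/-!
An internal algebra of a model `X` is an object `x` with cells `α(x, ..., x) ⟶ x` for the
operations `α`. The comultiplication `intAlgComult` sends it to itself, regarded as an internal
algebra of `IntAlg X` with the same cells (`LaxHom.diag`); these cells are modifications because
the cells of a lax homomorphism are compatible with the Gray cells. The axioms of a 2-comonad then
hold by inspection of the components.

The inverse of the comultiplication can only be the evaluation at `IntAlg X`, and it is an inverse
as soon as every internal algebra of `IntAlg X` is a diagonal. Such an algebra amounts to two
algebra structures `a` and `b` on one object `x` of `X` with an interchange law involving the Gray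
cells `σ β α`, and it has to be shown that `a = b`. The operations on which `a` and `b` agree
contain the inert ones and are closed under composition, so a basis suffices
(`agree_of_isBasis`); its members are nullary or unital.

* For a nullary operation `u` the interchange law says that `a` and `b` differ by `σ u u`.
  Naturality of the Gray cells shows that parallel 2-cells between nullary operations act equally,
  whence `σ u u` is the identity (`sig_nullary`).
* For a unital operation `α` of arity `n` consider the `n × n` matrix with a tuple `z` on the
  diagonal and units elsewhere. By the unit laws, `α` applied to any row or column gives back the
  diagonal entry. Restricting the interchange law along the map from this matrix to the constant
  matrix `x` shows that `a` and `b` differ at `α` by an endomorphism of `α(z)`, with `z` constant,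
  obtained from `σ α α` (`Interchange.agree_unital`). This endomorphism comes from an endo-2-cell
  `t` of `α` in the theory (`exists_op₂_swap`). If all entries of `z` but one are units, then `t`
  acts as the identity, by naturality of the Gray cells with respect to the unit law
  (`map_rowIso_sig_insTuple`). In particular it does so on the columns of the matrix; as `σ α α`
  is invertible and natural with respect to `t`, it does so on the values of `α` at the rows,
  which are isomorphic to the entries of the arbitrary tuple `z` (`map_rowIso_sig`).
-/

/-! ### The 2-comonad of internal algebras -/

namespace LaxHom

variable (μ : T.LaxCommutativity) {X Y : Model T}

/-- The internal algebra `f` of `X` as an internal algebra of `IntAlg X`: the underlying object is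
`f` itself and the structure cells are those of `f`, which are modifications because the cells of a
lax homomorphism are compatible with the Gray cells. -/
def diag (f : LaxHom (terminalModel T) X) :
    LaxHom (terminalModel T) (internalHom μ (terminalModel T) X) where
  F := (Functor.const _).obj f
  cell α x i :=
    { app :=
        { app := fun y => f.cell α (fun _ => y) i
          naturality := fun y y' a => f.cell_naturality α (fun _ => a) i }
      comm := fun β y j => (Category.assoc _ _ _).trans <|
        (f.cell_sig μ β α (fun l _ => y l) j i).trans <|
          (congrArg (_ ≫ ·) (f.F.map_id _)).trans (Category.comp_id _) }
  cell_naturality α x y a i := hom_ext fun y =>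
    ((congrArg (· ≫ _) ((X.op_map_id α i _))).trans (Category.id_comp _)).trans
      (Category.comp_id _).symm
  cell_op₂ s x i := hom_ext fun y =>
    (congrArg (_ ≫ ·) (f.F.map_id _).symm).trans (f.cell_op₂ s (fun _ => y) i)
  cell_inert p x i := hom_hext (opHom_inert μ p i _) rfl fun y => f.cell_inert p _ i
  cell_comp α β x i := hom_hext (opHom_comp μ α β i _) rfl fun y => f.cell_comp α β _ i

/-- A modification of internal algebras, as a modification of their diagonal internal algebras. -/
def diagMap {f g : LaxHom (terminalModel T) X} (t : f ⟶ g) : diag μ f ⟶ diag μ g where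
  app := (Functor.const _).map t
  comm α x i := hom_ext fun y => t.comm α (fun _ => y) i

end LaxHom

theorem LaxHom.app_hcongr {X Y : Model T} {f g f' g' : LaxHom X Y} {s : f ⟶ g} {t : f' ⟶ g'}
    (hf : f = f') (hg : g = g') (h : s ≍ t) (x : X.C) : s.app.app x ≍ t.app.app x := by
  subst hf hg h
  rfl

/-- Gray cells of an internal hom are computed pointwise. -/
theorem internalHom_sig_app (μ : T.LaxCommutativity) (Y Z : Model T) {m n p q : T.Ob} (β : p ⟶ q)
    (α : m ⟶ n) (M : p.Ix → m.Ix → LaxHom Y Z) (j : q.Ix) (i : n.Ix) (y : Y.C) :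
    (LaxHom.Modif.app ((internalHom μ Y Z).sig μ β α M j i)).app y =
      Z.sig μ β α (fun l k => (M l k).F.obj y) j i :=
  eq_of_heq <| (LaxHom.app_hcongr ((internalHom μ Y Z).sig_source μ β α M j i).symm
    ((internalHom μ Y Z).sig_target μ β α M j i).symm
    ((internalHom μ Y Z).sig_heq μ β α M j i) y).trans
      (Z.sig_heq μ β α (fun l k => (M l k).F.obj y) j i).symm

/-- The diagonal commutes strictly with the operations. -/
theorem LaxHom.opHom_diag_cell (μ : T.LaxCommutativity) {X : Model T} {m n p q : T.Ob}
    (α : m ⟶ n) (i : n.Ix) (f : m.Ix → LaxHom (terminalModel T) X) (β : p ⟶ q)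
    (y : p.Ix → (terminalModel T).C) (j : q.Ix) :
    (LaxHom.opHom μ α i fun k => LaxHom.diag μ (f k)).cell β y j =
      (LaxHom.diag μ (LaxHom.opHom μ α i f)).cell β y j :=
  LaxHom.hom_ext fun z => congrArg (· ≫ _) (internalHom_sig_app μ _ X β α _ j i z)

/-- The comultiplication `IntAlg X ⟶ IntAlg (IntAlg X)`, the strict homomorphism sending an internal
algebra to its diagonal. -/
def intAlgComult (μ : T.LaxCommutativity) (X : Model T) :
    (intAlg μ).obj X ⟶ (intAlg μ).obj ((intAlg μ).obj X) where
  F :=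
    { obj := fun f => LaxHom.diag μ f
      map := fun t => LaxHom.diagMap μ t
      map_id := fun f => rfl
      map_comp := fun s t => rfl }
  cell α f i :=
    { app := { app := fun y => 𝟙 _, naturality := fun y y' a => by
                refine (Category.comp_id _).trans (Eq.trans ?_ (Category.id_comp _).symm)
                exact LaxHom.hom_ext fun z => X.op_map_id α i _ }
      comm := fun β y j => (Category.comp_id _).trans <|
        (LaxHom.opHom_diag_cell μ α i f β y j).trans <|
          ((congrArg (· ≫ _) (Model.op_map_id _ β j _)).trans (Category.id_comp _)).symm }
  cell_naturality α f f' t i := LaxHom.hom_ext fun y =>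
      (Category.comp_id _).trans (Category.id_comp _).symm
  cell_op₂ s f i := LaxHom.hom_ext fun y => (Category.id_comp _).trans (Category.comp_id _).symm
  cell_inert p f i := LaxHom.hom_hext (LaxHom.opHom_inert μ p i _)
    (congrArg (LaxHom.diag μ) (LaxHom.opHom_inert μ p i f)) fun y =>
      id_hcongr (LaxHom.opHom_inert μ p i f)
  cell_comp α β f i := LaxHom.hom_hext (LaxHom.opHom_comp μ α β i _)
    (congrArg (LaxHom.diag μ) (LaxHom.opHom_comp μ α β i f)) fun y => by
    refine (id_hcongr (LaxHom.opHom_comp μ α β i f)).trans (heq_of_eq ?_)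
    refine ((congrArg (· ≫ 𝟙 _) ?_).trans (Category.id_comp _)).symm
    exact LaxHom.hom_ext fun y => X.op_map_id β i _

namespace LaxHom

variable (μ : T.LaxCommutativity) {X Y : Model T}

theorem diag_comp_internalMap (f : LaxHom (terminalModel T) X) (g : LaxHom X Y) :
    comp (diag μ f) (internalMap μ (terminalModel T) g) = diag μ (comp f g) :=
  hext (fun _ => rfl) (fun _ => heq_of_eq (hom_ext fun _ => g.F.map_id _)) fun _ _ _ => HEq.rfl

theorem diag_comp_eval (f : LaxHom (terminalModel T) X) :
    comp (diag μ f) (intAlgEval μ X) = f :=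
  hext (fun _ => rfl) (fun _ => heq_of_eq (f.F.map_id _).symm) fun _ _ _ =>
    heq_of_eq (Category.id_comp _)

theorem diag_comp_comult (f : LaxHom (terminalModel T) X) :
    comp (diag μ f) (intAlgComult μ X) = diag μ (diag μ f) :=
  hext (fun _ => rfl) (fun _ => HEq.rfl) fun _ _ _ => heq_of_eq <| hom_ext fun _ =>
    Category.id_comp _

end LaxHom

theorem intAlgComult_natural (μ : T.LaxCommutativity) {X Y : Model T} (f : X ⟶ Y) :
    (intAlg μ).map f ≫ intAlgComult μ Y =
      intAlgComult μ X ≫ (intAlg μ).map ((intAlg μ).map f) :=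
  LaxHom.hext (fun x => (LaxHom.diag_comp_internalMap μ x f).symm)
    (fun a => LaxHom.hom_hext (LaxHom.diag_comp_internalMap μ _ f).symm
      (LaxHom.diag_comp_internalMap μ _ f).symm fun y => HEq.rfl) fun α x i =>
    LaxHom.hom_hext
      (LaxHom.opHom_hcongr μ α i fun k => (LaxHom.diag_comp_internalMap μ (x k) f).symm)
      (LaxHom.diag_comp_internalMap μ _ f).symm fun y =>
        heq_of_eq <| LaxHom.hom_ext fun z =>
          (Category.id_comp _).trans <|
      ((congrArg (_ ≫ ·) ((LaxHom.F f).map_id _)).trans (Category.comp_id _)).symm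

theorem intAlgEval_natural (μ : T.LaxCommutativity) {X Y : Model T} (f : X ⟶ Y) :
    (intAlg μ).map f ≫ intAlgEval μ Y = intAlgEval μ X ≫ f :=
  LaxHom.hext (fun x => rfl) (fun a => HEq.rfl) fun α x i => heq_of_eq <|
    (Category.id_comp _).trans <|
      ((congrArg (_ ≫ ·) ((LaxHom.F f).map_id _)).trans (Category.comp_id _)).symm

/-- The 2-comonad with counit the evaluation and comultiplication the diagonal. -/
def intAlgComonad (μ : T.LaxCommutativity) : TwoComonad (intAlg μ) where
  counit := intAlgEval μ
  comult := intAlgComult μ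
  counit_natural := intAlgEval_natural μ
  counit_natural₂ {X Y f g} η := LaxHom.hom_hext (intAlgEval_natural μ f) (intAlgEval_natural μ g)
    fun x => HEq.rfl
  comult_natural := intAlgComult_natural μ
  comult_natural₂ {X Y f g} η := LaxHom.hom_hext (intAlgComult_natural μ f)
    (intAlgComult_natural μ g) fun x => LaxHom.hom_hext (LaxHom.diag_comp_internalMap μ x f).symm
      (LaxHom.diag_comp_internalMap μ x g).symm fun y => HEq.rfl
  counit_left X := LaxHom.hext (fun x => rfl) (fun a => HEq.rfl) fun α x i =>
    heq_of_eq (LaxHom.hom_ext fun y => Category.id_comp _)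
  counit_right X := LaxHom.hext (fun f => LaxHom.diag_comp_eval μ f)
    (fun a => LaxHom.hom_hext (LaxHom.diag_comp_eval μ _) (LaxHom.diag_comp_eval μ _)
      fun y => HEq.rfl) fun α f i =>
    LaxHom.hom_hext (LaxHom.opHom_hcongr μ α i fun k => LaxHom.diag_comp_eval μ (f k))
      (LaxHom.diag_comp_eval μ _) fun y => heq_of_eq (Category.id_comp _)
  coassoc X := LaxHom.hext (fun f => (LaxHom.diag_comp_comult μ f).symm)
    (fun a => LaxHom.hom_hext (LaxHom.diag_comp_comult μ _).symm (LaxHom.diag_comp_comult μ _).symm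
      fun y => HEq.rfl) fun α f i =>
    LaxHom.hom_hext (LaxHom.opHom_hcongr μ α i fun k => (LaxHom.diag_comp_comult μ (f k)).symm)
      (LaxHom.diag_comp_comult μ _).symm fun y => HEq.rfl

/-! ### 1-cells and 2-cells determined by their components -/

namespace LawvereTwoTheory

instance : IsEmpty (zero : T.Ob).Ix := inferInstanceAs (IsEmpty (Fin 0))

theorem existsUnique_hom {m n : T.Ob} (a : n.Ix → (m ⟶ one)) :
    ∃! α : m ⟶ n, ∀ i, α ≫ proj i = a i :=
  T.existsUnique_tuple a

theorem existsUnique_hom₂ {m n : T.Ob} (α β : m ⟶ n)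
    (s : ∀ i, α ≫ proj i ⟶ β ≫ proj i) : ∃! t : α ⟶ β, ∀ i, t ▷ proj i = s i :=
  T.existsUnique_tuple₂ α β s

theorem hom_ext {m n : T.Ob} {α β : m ⟶ n} (h : ∀ i, α ≫ proj i = β ≫ proj i) : α = β :=
  (existsUnique_hom fun i => β ≫ proj i).unique h fun _ => rfl

theorem hom_zero_ext {m : T.Ob} (α β : m ⟶ zero) : α = β :=
  hom_ext fun i => isEmptyElim i

end LawvereTwoTheory

namespace Model

variable (X : Model T) {m n k : T.Ob}

theorem op_comp_proj (α : m ⟶ n) (i : n.Ix) (j : (one : T.Ob).Ix) :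
    X.op (α ≫ proj i) j = X.op α i := by
  rw [X.op_comp, proj, X.op_inert]
  rfl

theorem op₂_cast {α α' β β' : m ⟶ n} (h : α' = α) (s : α ⟶ β) (h' : β = β') (i : n.Ix)
    (x : m.Ix → X.C) :
    (X.op₂ (eqToHom h ≫ s ≫ eqToHom h') i).app x ≍ (X.op₂ s i).app x := by
  subst h h'
  simp

instance op₂_isIso {α β : m ⟶ n} (s : α ⟶ β) [IsIso s] (i : n.Ix) : IsIso (X.op₂ s i) :=
  ⟨X.op₂ (inv s) i, by rw [← X.op₂_comp, IsIso.hom_inv_id, X.op₂_id],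
    by rw [← X.op₂_comp, IsIso.inv_hom_id, X.op₂_id]⟩

theorem exists_tuple₂ {α β : m ⟶ n} {a b : n.Ix → (m ⟶ one)} (hα : ∀ i, α ≫ proj i = a i)
    (hβ : ∀ i, β ≫ proj i = b i) (s : ∀ i, a i ⟶ b i) :
    ∃ t : α ⟶ β, ∀ (i : n.Ix) (x : m.Ix → X.C),
      (X.op₂ t i).app x ≍ (X.op₂ (s i) pt).app x := by
  obtain ⟨t, ht, -⟩ := existsUnique_hom₂ α β
    fun i => eqToHom (hα i) ≫ s i ≫ eqToHom (hβ i).symm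
  refine ⟨t, fun i x => ?_⟩
  have h := X.op₂_whiskerRight_inert t (γ := proj i) rfl pt x
  refine h.symm.trans (HEq.trans ?_ (X.op₂_cast (hα i) (s i) (hβ i).symm pt x))
  exact heq_of_eq (congrArg (fun c => (X.op₂ c pt).app x) (ht i))

variable (μ : T.LaxCommutativity)

/-! ### Gray cells of composites with inert 1-cells -/

section

variable {p q r : T.Ob}

instance sig_isIso (β : p ⟶ q) (α : m ⟶ n) [IsIso (μ.gray β α)] (M : p.Ix → m.Ix → X.C)
    (j : q.Ix) (i : n.Ix) : IsIso (X.sig μ β α M j i) := by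
  unfold sig
  infer_instance

theorem sig_congr {β β' : p ⟶ q} {α α' : m ⟶ n} (hβ : β = β') (hα : α = α')
    {M M' : p.Ix → m.Ix → X.C} (hM : ∀ l k, M l k = M' l k) (j : q.Ix) (i : n.Ix) :
    X.sig μ β α M j i ≍ X.sig μ β' α' M' j i := by
  obtain rfl : M = M' := funext fun l => funext fun k => hM l k
  subst hβ hα
  rfl

theorem sig_comp_proj_left (β : p ⟶ q) (α : m ⟶ n) (M : p.Ix → m.Ix → X.C) (l : q.Ix)
    (j : (one : T.Ob).Ix) (i : n.Ix) :
    X.sig μ (β ≫ proj l) α M j i ≍ X.sig μ β α M l i := by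
  refine (X.sig_comp_left μ β (proj l) α M j i).trans ((comp_heq_left ?_ ?_
    (X.sig_inert_left μ _ α _ j i)).trans (X.op_inert_map _ j _))
  · simp [op_inert_obj]
  · simp [op_inert_obj]

theorem sig_comp_proj_right (β : p ⟶ q) (α : m ⟶ n) (M : p.Ix → m.Ix → X.C) (j : q.Ix)
    (l : n.Ix) (i : (one : T.Ob).Ix) :
    X.sig μ β (α ≫ proj l) M j i ≍ X.sig μ β α M j l := by
  refine (X.sig_comp_right μ β α (proj l) M j i).trans ((comp_heq_right ?_ ?_
    (X.sig_inert_right μ β _ _ j i)).trans (X.op_inert_map _ i _))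
  · simp [op_inert_obj]
  · simp [op_inert_obj]

theorem sig_inert_comp_left (a : q.Ix → p.Ix) (β : q ⟶ r) (α : m ⟶ n) (M : p.Ix → m.Ix → X.C)
    (j : r.Ix) (i : n.Ix) :
    X.sig μ (θ a ≫ β) α M j i ≍ X.sig μ β α (fun l => M (a l)) j i := by
  refine (X.sig_comp_left μ (θ a) β α M j i).trans ((comp_heq_right ?_ ?_
    (X.op_map_heq_id β j ?_ ?_ fun l => X.sig_inert_left μ a α M l i)).trans
    (X.sig_congr μ rfl rfl (fun l k => X.op_inert_obj a l _) j i))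
  all_goals simp [op_inert_obj]

theorem sig_inert_comp_right (β : p ⟶ q) (a : n.Ix → m.Ix) (α : n ⟶ k) (M : p.Ix → m.Ix → X.C)
    (j : q.Ix) (i : k.Ix) :
    X.sig μ β (θ a ≫ α) M j i ≍ X.sig μ β α (fun l k => M l (a k)) j i := by
  refine (X.sig_comp_right μ β (θ a) α M j i).trans ((comp_heq_left ?_ ?_
    (X.op_map_heq_id α i ?_ ?_ fun l => X.sig_inert_right μ β a M j l)).trans
    (X.sig_congr μ rfl rfl (fun l k => X.op_inert_obj a k _) j i))
  all_goals simp [op_inert_obj]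

end

/-! ### Nullary operations -/

section Nullary

theorem op_map_zero (v : (zero : T.Ob) ⟶ n) (i : n.Ix) {x y z : (zero : T.Ob).Ix → X.C}
    (f : ∀ k, x k ⟶ y k) : (X.op v i).map f ≍ 𝟙 ((X.op v i).obj z) :=
  X.op_map_heq_id v i (fun k => isEmptyElim k) (fun k => isEmptyElim k) fun k => isEmptyElim k

/-- Parallel 2-cells between nullary operations act equally: naturality of the Gray cell of `u` and
`v` in `u` gives `s ≫ σ v v = σ u v` for every 2-cell `s : u ⟶ v`, and `σ v v` is invertible. -/
theorem op₂_nullary_eq {u v : (zero : T.Ob) ⟶ one} [IsIso (μ.gray v v)] (s t : u ⟶ v) :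
    X.op₂ s pt = X.op₂ t pt := by
  ext x
  have h (s : u ⟶ v) := X.sig_op₂_left μ s v (fun _ => x) pt pt
  have h' (s : u ⟶ v) : X.sig μ u v (fun _ => x) pt pt ≍
      (X.op₂ s pt).app (fun l => (X.op v pt).obj x) ≫ X.sig μ v v (fun _ => x) pt pt := by
    refine HEq.trans ?_ (heq_of_eq (h s))
    refine (comp_heq_left ?_ rfl (X.op_map_zero v pt _)).symm
    exact congrArg _ (funext fun k => isEmptyElim k)
  have h₂ := (cancel_mono _).1 (eq_of_heq ((h' s).symm.trans (h' t)))
  have e : (fun _ : (zero : T.Ob).Ix => (X.op v pt).obj x) = x := funext fun k => isEmptyElim k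
  rwa [e] at h₂

/-- The Gray cell of a nullary operation `u` with itself is given by a 2-cell `u ⟶ u` of the theory.
-/
theorem exists_op₂_sig_nullary (u : (zero : T.Ob) ⟶ one) :
    ∃ t : u ⟶ u, ∀ x (M : (zero : T.Ob).Ix → (zero : T.Ob).Ix → X.C),
      (X.op₂ t pt).app x ≍ X.sig μ u u M pt pt := by
  let a : (zero.mul zero : T.Ob).Ix → (zero : T.Ob).Ix := fst
  let b : (one : T.Ob).Ix → (one.mul one : T.Ob).Ix := fun i => pair i pt
  have hb : b = fun i => pair pt i := by
    funext i
    rw [eq_pt i]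
  have h₁ : θ a ≫ ((μ.right zero).map u ≫ (μ.left one).map u) ≫ θ b = u := by
    rw [Category.assoc, μ.left_one, ← Category.assoc, ← Category.assoc,
      hom_zero_ext ((θ a ≫ (μ.right zero).map u) ≫ _) (𝟙 _), Category.id_comp]
  have h₂ : θ a ≫ ((μ.left zero).map u ≫ (μ.right one).map u) ≫ θ b = u := by
    rw [Category.assoc, hb, μ.right_one, ← Category.assoc, ← Category.assoc,
      hom_zero_ext ((θ a ≫ (μ.left zero).map u) ≫ _) (𝟙 _), Category.id_comp]
  refine ⟨eqToHom h₁.symm ≫ (θ a ◁ (μ.gray u u ▷ θ b)) ≫ eqToHom h₂, fun x M => ?_⟩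
  refine (X.op₂_cast _ _ _ _ _).trans ((X.op₂_whiskerLeft_inert _ rfl _ _).trans
    ((X.op₂_whiskerRight_inert _ rfl _ _).trans (HEq.trans ?_ (X.sig_heq μ u u M pt pt).symm)))
  exact app_hcongr _ (funext fun k => isEmptyElim (fst k))

theorem sig_nullary (u : (zero : T.Ob) ⟶ one) [IsIso (μ.gray u u)]
    (M : (zero : T.Ob).Ix → (zero : T.Ob).Ix → X.C) (x : (zero : T.Ob).Ix → X.C) :
    X.sig μ u u M pt pt ≍ 𝟙 ((X.op u pt).obj x) := by
  obtain ⟨t, ht⟩ := X.exists_op₂_sig_nullary μ u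
  refine (ht x M).symm.trans (heq_of_eq ?_)
  rw [X.op₂_nullary_eq μ t (𝟙 u), X.op₂_id]
  rfl

end Nullary

end Model

/-! ### Unital operations -/

namespace LawvereTwoTheory

/-- A choice of witnesses for the unitality of an operation: a nullary operation, the corresponding
unit insertions, and isomorphisms exhibiting the unit laws. -/
structure UnitalStructure {n : T.Ob} (α : n ⟶ one) where
  unit : (zero : T.Ob) ⟶ one
  ins (k : n.Ix) : one ⟶ n
  isUnitInsertion (k : n.Ix) : IsUnitInsertion unit k (ins k)
  iso (k : n.Ix) : 𝟙 one ≅ ins k ≫ α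

theorem IsUnital.nonempty_unitalStructure {n : T.Ob} {α : n ⟶ one} (h : IsUnital α) :
    Nonempty (UnitalStructure α) := by
  obtain ⟨u, hu⟩ := h
  choose w hw e using hu
  exact ⟨⟨u, w, hw, fun k => (e k).some⟩⟩

namespace UnitalStructure

variable {n : T.Ob} {α : n ⟶ one} (U : UnitalStructure α)

theorem ins_proj_self (k : n.Ix) : U.ins k ≫ proj k = 𝟙 one :=
  (U.isUnitInsertion k k).trans (if_pos rfl)

theorem ins_proj_of_ne {k i : n.Ix} (h : i ≠ k) :
    U.ins k ≫ proj i = θ (fun _ => pt) ≫ U.unit :=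
  (U.isUnitInsertion k i).trans (if_neg h)

theorem zero_comp_unit {m : T.Ob} (a : m ⟶ one) (c : one ⟶ zero) (b : m ⟶ zero) :
    a ≫ c ≫ U.unit = b ≫ U.unit := by
  rw [← Category.assoc, hom_zero_ext (a ≫ c) b]

theorem unit_ins (k l : n.Ix) : U.unit ≫ U.ins k = U.unit ≫ U.ins l := by
  have key (k i : n.Ix) : (U.unit ≫ U.ins k) ≫ proj i = U.unit := by
    rw [Category.assoc]
    by_cases h : i = k
    · subst h
      rw [ins_proj_self, Category.comp_id]
    · rw [U.ins_proj_of_ne h, U.zero_comp_unit _ _ (𝟙 _), Category.id_comp]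
  exact hom_ext fun i => (key k i).trans (key l i).symm

/-- Both sides are the composite through the nullary operation unless `l = k`; this is the symmetry
of the matrix `unitMat` below. -/
theorem proj_ins_proj (l k : n.Ix) :
    proj l ≫ U.ins l ≫ proj k = proj k ≫ U.ins k ≫ proj l := by
  by_cases h : k = l
  · rw [h]
  · rw [U.ins_proj_of_ne h, U.ins_proj_of_ne (Ne.symm h)]
    exact (U.zero_comp_unit _ _ (proj k ≫ θ fun _ => pt)).trans (Category.assoc _ _ _)

/-- Unless `l = k`, both sides factor through the nullary operation, and `unit_ins` applies. -/
theorem ins_proj_ins (k l : n.Ix) :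
    U.ins k ≫ proj l ≫ U.ins l = U.ins k ≫ proj l ≫ U.ins k := by
  by_cases h : l = k
  · rw [h]
  · rw [← Category.assoc, ← Category.assoc, U.ins_proj_of_ne h, Category.assoc, Category.assoc,
      U.unit_ins l k]

theorem ins_proj_ins_proj (k i l : n.Ix) :
    U.ins k ≫ proj i ≫ U.ins k ≫ proj l = U.ins k ≫ proj l ≫ U.ins k ≫ proj i := by
  have h (i l : n.Ix) : U.ins k ≫ proj i ≫ U.ins k ≫ proj l =
      U.ins k ≫ proj i ≫ U.ins i ≫ proj l := by
    simpa using congrArg (· ≫ proj l) (U.ins_proj_ins k i).symm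
  rw [h, h, proj_ins_proj]

end UnitalStructure

end LawvereTwoTheory

namespace Model

variable (X : Model T)

theorem op_id_obj {m : T.Ob} (i : m.Ix) (x : m.Ix → X.C) : (X.op (𝟙 m) i).obj x = x i := by
  rw [← θ_id, op_inert_obj]
  rfl

theorem op_id_map {m : T.Ob} (i : m.Ix) {x y : m.Ix → X.C} (f : x ⟶ y) :
    (X.op (𝟙 m) i).map f ≍ f i := by
  rw [← θ_id]
  exact X.op_inert_map _ i f

/-- The natural isomorphism between operations given by an invertible 2-cell. -/
def op₂Iso {m n : T.Ob} {α β : m ⟶ n} (s : α ≅ β) (i : n.Ix) : X.op α i ≅ X.op β i where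
  hom := X.op₂ s.hom i
  inv := X.op₂ s.inv i
  hom_inv_id := by rw [← op₂_comp, s.hom_inv_id, op₂_id]
  inv_hom_id := by rw [← op₂_comp, s.inv_hom_id, op₂_id]

variable {n : T.Ob} {α : n ⟶ one} (U : UnitalStructure α)

/-- The unit law of a unital operation, at an object `z` of `X`. -/
def insIso (l : n.Ix) (z : X.C) :
    z ≅ (X.op α pt).obj fun k => (X.op (U.ins l) k).obj fun _ => z :=
  eqToIso (X.op_id_obj pt fun _ => z).symm ≪≫ (X.op₂Iso (U.iso l) pt).app (fun _ => z) ≪≫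
    eqToIso (X.op_comp_obj _ _ _ _)

theorem insIso_hom_heq (l : n.Ix) (z : X.C) :
    (X.insIso U l z).hom ≍ (X.op₂ (U.iso l).hom pt).app fun _ => z := by
  simp only [insIso, Iso.trans_hom, eqToIso.hom]
  exact (eqToHom_comp_heq _ _).trans (comp_eqToHom_heq _ _)

theorem insIso_inv_heq (l : n.Ix) (z : X.C) :
    (X.insIso U l z).inv ≍ (X.op₂ (U.iso l).inv pt).app fun _ => z := by
  simp only [insIso, Iso.trans_inv, eqToIso.inv, Category.assoc]
  exact (eqToHom_comp_heq _ _).trans (comp_eqToHom_heq _ _)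

theorem insIso_naturality (l : n.Ix) {z z' : X.C} (f : z ⟶ z') :
    f ≫ (X.insIso U l z').hom = (X.insIso U l z).hom ≫
      (X.op α pt).map fun k => (X.op (U.ins l) k).map fun _ => f := by
  have h := X.op₂_naturality (U.iso l).hom pt (x := fun _ => z) (y := fun _ => z') fun _ => f
  refine eq_of_heq ((comp_hcongr ?_ ?_ ?_ (X.op_id_map pt _).symm
    (X.insIso_hom_heq U l z')).trans ((heq_of_eq h).trans (comp_hcongr ?_ ?_ ?_
      (X.insIso_hom_heq U l z).symm (X.op_comp_map _ _ _ _))))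
  all_goals simp [op_id_obj, op_comp_obj]

/-- The matrix with diagonal `y` and with the value of the nullary operation off the diagonal. -/
def unitMat (y : n.Ix → X.C) (l k : n.Ix) : X.C := (X.op (U.ins l) k).obj fun _ => y l

theorem unitMat_symm (y : n.Ix → X.C) (l k : n.Ix) : X.unitMat U y l k = X.unitMat U y k l := by
  have h := congrArg (fun a => (X.op a pt).obj y) (U.proj_ins_proj l k)
  simp only [op_comp_obj, proj, op_inert_obj] at h
  exact h

/-- The unit law identifies the diagonal entry with the operation applied to its row. -/
def rowIso (y : n.Ix → X.C) (l : n.Ix) : y l ≅ (X.op α pt).obj (X.unitMat U y l) :=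
  X.insIso U l (y l)

/-- The unit law identifies the diagonal entry with the operation applied to its column. -/
def colIso (y : n.Ix → X.C) (k : n.Ix) :
    y k ≅ (X.op α pt).obj fun l => X.unitMat U y l k :=
  X.insIso U k (y k) ≪≫
    eqToIso (congrArg (X.op α pt).obj (funext fun l => X.unitMat_symm U y k l))

theorem colIso_inv_heq (y : n.Ix → X.C) (k : n.Ix) :
    (X.colIso U y k).inv ≍ (X.insIso U k (y k)).inv := by
  simp only [colIso, Iso.trans_inv, eqToIso.inv]
  exact eqToHom_comp_heq _ _

theorem colIso_hom_heq (y : n.Ix → X.C) (k : n.Ix) :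
    (X.colIso U y k).hom ≍ (X.insIso U k (y k)).hom := by
  simp only [colIso, Iso.trans_hom, eqToIso.hom]
  exact comp_eqToHom_heq _ _

variable (μ : T.LaxCommutativity)

theorem op₂_paste₃ {m k : T.Ob} {a₀ a₁ a₂ a₃ a₄ a₅ a₆ a₇ : m ⟶ k} (h₁ : a₀ = a₁) (A : a₁ ⟶ a₂)
    (h₂ : a₂ = a₃) (B : a₃ ⟶ a₄) (h₃ : a₄ = a₅) (D : a₅ ⟶ a₆) (h₄ : a₆ = a₇) (i : k.Ix)
    (x : m.Ix → X.C) {P Q R S : X.C} {f : P ⟶ Q} {g : Q ⟶ R} {h : R ⟶ S}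
    (hP : (X.op a₁ i).obj x = P) (hQ : (X.op a₂ i).obj x = Q)
    (hR : (X.op a₄ i).obj x = R) (hS : (X.op a₆ i).obj x = S) (hf : (X.op₂ A i).app x ≍ f)
    (hg : (X.op₂ B i).app x ≍ g) (hh : (X.op₂ D i).app x ≍ h) :
    (X.op₂ (eqToHom h₁ ≫ A ≫ eqToHom h₂ ≫ B ≫ eqToHom h₃ ≫ D ≫ eqToHom h₄) i).app x ≍
      f ≫ g ≫ h := by
  subst h₁ h₂ h₃ h₄
  simp only [eqToHom_refl, Category.id_comp, Category.comp_id, op₂_comp_app]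
  exact comp_hcongr hP hQ hS hf (comp_hcongr hQ hR hS hg hh)

/-- The Gray cell of a unital operation `α` with itself, at the matrix with diagonal `y` and units
off the diagonal, becomes an endomorphism of `α` applied to `y` after collapsing rows and columns by
the unit laws. This endomorphism is the value of an endo-2-cell of `α` in the theory, so that the
Gray cells are natural with respect to it. -/
theorem exists_op₂_swap : ∃ t : α ⟶ α, ∀ y : n.Ix → X.C, (X.op₂ t pt).app y =
    (X.op α pt).map (fun l => (X.rowIso U y l).hom) ≫ X.sig μ α α (X.unitMat U y) pt pt ≫
      (X.op α pt).map (fun k => (X.colIso U y k).inv) := by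
  -- `E` is the 1-cell forming the matrix; `c` and `d` below collapse its rows and its columns.
  obtain ⟨E, hE, -⟩ := existsUnique_hom
    fun i : (n.mul n).Ix => proj (fst i) ≫ U.ins (fst i) ≫ proj (snd i)
  have hE₁ (l : n.Ix) : E ≫ θ (fun k => pair l k) = proj l ≫ U.ins l := hom_ext fun k => by
    rw [Category.assoc, proj, ← θ_comp]
    refine (hE (pair l k)).trans ?_
    rw [fst_pair, snd_pair, Category.assoc]
    rfl
  have hE₂ (k : n.Ix) : E ≫ θ (fun l => pair l k) = proj k ≫ U.ins k := hom_ext fun l => by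
    rw [Category.assoc, proj, ← θ_comp]
    refine (hE (pair l k)).trans ?_
    rw [fst_pair, snd_pair, Category.assoc, U.proj_ins_proj]
    rfl
  have hEX (y : n.Ix → X.C) :
      (fun i => (X.op E i).obj y) = flat (X.unitMat U y) := funext fun i => by
    have h := congrArg (fun a => (X.op a pt).obj y) (hE i)
    simp only [op_comp_obj, proj, op_inert_obj] at h
    exact h
  obtain ⟨c, hc⟩ := X.exists_tuple₂ (α := θ (fst : (n.mul one).Ix → n.Ix))
    (β := E ≫ (μ.right n).map α) (a := fun i => proj (fst i) ≫ 𝟙 one)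
    (b := fun i => proj (fst i) ≫ U.ins (fst i) ≫ α)
    (fun i => by rw [proj, ← θ_comp, Category.comp_id]; rfl)
    (fun i => by
      have h := μ.right_row n α (fst i)
      have hi : proj i = θ (fun j : (one : T.Ob).Ix => pair (fst i) j) := by
        refine congrArg θ (funext fun j => ?_)
        rw [eq_pt j, ← eq_pt (snd i), pair_fst_snd]
      rw [hi, Category.assoc, h, ← Category.assoc, hE₁, Category.assoc])
    fun i => proj (fst i) ◁ (U.iso (fst i)).hom
  obtain ⟨d, hd⟩ := X.exists_tuple₂ (α := E ≫ (μ.left n).map α)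
    (β := θ (snd : (one.mul n).Ix → n.Ix)) (a := fun i => proj (snd i) ≫ U.ins (snd i) ≫ α)
    (b := fun i => proj (snd i) ≫ 𝟙 one)
    (fun i => by
      have h := μ.left_col n α (snd i)
      have hi : proj i = θ (fun j : (one : T.Ob).Ix => pair j (snd i)) := by
        refine congrArg θ (funext fun j => ?_)
        rw [eq_pt j, ← eq_pt (fst i), pair_fst_snd]
      rw [hi, Category.assoc, h, ← Category.assoc, hE₂, Category.assoc])
    (fun i => by rw [proj, ← θ_comp, Category.comp_id]; rfl)
    fun i => proj (snd i) ◁ (U.iso (snd i)).inv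
  let b : (one : T.Ob).Ix → (one.mul one : T.Ob).Ix := fun i => pair i pt
  have hb : b = fun i => pair pt i := by
    funext i
    rw [eq_pt i]
  have h₁ : α = (θ fst ≫ (μ.left one).map α) ≫ θ b := by
    rw [Category.assoc, μ.left_one, ← Category.assoc, ← θ_comp]
    have h : (fst : (n.mul one : T.Ob).Ix → n.Ix) ∘ (fun i => pair i pt) = id :=
      funext fun j => fst_pair _ _
    rw [h, θ_id, Category.id_comp]
  have h₂ : (θ snd ≫ (μ.right one).map α) ≫ θ b = α := by
    rw [Category.assoc, hb, μ.right_one, ← Category.assoc, ← θ_comp]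
    have h : (snd : (one.mul n : T.Ob).Ix → n.Ix) ∘ (fun j => pair pt j) = id :=
      funext fun j => snd_pair _ _
    rw [h, θ_id, Category.id_comp]
  have hr (y : n.Ix → X.C) (l : n.Ix) : (X.op (E ≫ (μ.right n).map α) (pair l pt)).obj y =
      (X.op α pt).obj (X.unitMat U y l) := by
    rw [op_comp_obj, hEX, op_right_obj]
    simp [flat]
  have hl (y : n.Ix → X.C) (k : n.Ix) : (X.op (E ≫ (μ.left n).map α) (pair pt k)).obj y =
      (X.op α pt).obj fun l => X.unitMat U y l k := by
    rw [op_comp_obj, hEX, op_left_obj]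
    simp [flat]
  refine ⟨eqToHom h₁ ≫ ((c ▷ (μ.left one).map α) ▷ θ b) ≫ eqToHom (by simp) ≫
    (E ◁ μ.gray α α) ▷ θ b ≫ eqToHom (by simp) ≫ ((d ▷ (μ.right one).map α) ▷ θ b) ≫
      eqToHom h₂, fun y => eq_of_heq (X.op₂_paste₃ _ _ _ _ _ _ _ _ _ ?_ ?_ ?_ ?_ ?_ ?_ ?_)⟩
  · rw [← h₁]
  · rw [op_comp_obj, op_inert_obj, op_comp_obj, op_left_obj]
    exact congrArg _ (funext fun l => hr y l)
  · rw [← Category.assoc, op_comp_obj, op_inert_obj, op_comp_obj, op_right_obj]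
    exact congrArg _ (funext fun l => hl y l)
  · rw [h₂]
  · refine (X.op₂_whiskerRight_inert _ rfl pt y).trans ((X.op₂_whiskerRight _ _ _ y).trans
      ((X.op_left_map μ α pt pt _).trans (X.op_map_hcongr α pt ?_ ?_ ?_)))
    · intro l
      rw [op_inert_obj, fst_pair]
    · exact hr y
    · intro l
      refine (hc (pair l pt) y).trans ((X.op₂_whiskerLeft_inert _ rfl pt y).trans ?_)
      rw [fst_pair]
      exact (X.insIso_hom_heq U l (y l)).symm
  · refine (X.op₂_whiskerRight_inert _ rfl pt y).trans ((X.op₂_whiskerLeft _ _ _ y).trans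
      ((app_hcongr _ (hEX y)).trans (X.sig_heq μ α α _ pt pt).symm))
  · refine (X.op₂_whiskerRight_inert _ rfl pt y).trans ((X.op₂_whiskerRight _ _ _ y).trans
      ((X.op_right_map μ α pt pt _).trans (X.op_map_hcongr α pt ?_ ?_ ?_)))
    · exact hl y
    · intro l
      rw [op_inert_obj, snd_pair]
    · intro l
      refine (hd (pair pt l) y).trans ((X.op₂_whiskerLeft_inert _ rfl pt y).trans ?_)
      rw [snd_pair]
      exact ((X.colIso_inv_heq U y l).trans (X.insIso_inv_heq U l (y l))).symm

end Model
/-! ### Collapsing rows and columns of unit matrices -/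

namespace Model

variable (X : Model T) (μ : T.LaxCommutativity) {n : T.Ob} {α : n ⟶ one} (U : UnitalStructure α)

theorem op_ins_of_ne {k i : n.Ix} (h : i ≠ k) (x : (one : T.Ob).Ix → X.C)
    (z : (zero : T.Ob).Ix → X.C) :
    (X.op (U.ins k) i).obj x = (X.op U.unit pt).obj z := by
  rw [← X.op_comp_proj _ i pt, U.ins_proj_of_ne h, op_comp_obj]
  exact congrArg _ (funext fun j => isEmptyElim j)

theorem ins_ins_obj (k i l : n.Ix) (x : (one : T.Ob).Ix → X.C) :
    (X.op (U.ins k) i).obj (fun _ => (X.op (U.ins k) l).obj x) =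
      (X.op (U.ins k) l).obj (fun _ => (X.op (U.ins k) i).obj x) := by
  have h := congrArg (fun a => (X.op a pt).obj x) (U.ins_proj_ins_proj k l i)
  simp only [op_comp_obj, proj, op_inert_obj] at h
  exact h

/-- For the tuple with `x` in place `k`, the insertion in the `l`-th place can be replaced by the
insertion in the `k`-th place in the `l`-th row: for `l ≠ k` the row consists of units anyway. -/
theorem unitMat_ins (k : n.Ix) (x : X.C) :
    X.unitMat U (fun l => (X.op (U.ins k) l).obj fun _ => x) =
      fun l i => (X.op (U.ins k) i).obj fun _ => (X.op (U.ins k) l).obj fun _ => x := by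
  funext l i
  have h := congrArg (fun a => (X.op a i).obj fun _ => x) (U.ins_proj_ins k l)
  simp only [op_comp_obj, proj, op_inert_obj] at h
  exact h

theorem insIso_congr (k : n.Ix) {z z' : X.C} (h : z = z') :
    (X.insIso U k z).hom ≍ (X.insIso U k z').hom := by
  subst h; rfl

theorem op₂_nullary_hcongr [∀ v : (zero : T.Ob) ⟶ one, IsIso (μ.gray v v)]
    {u v v' : (zero : T.Ob) ⟶ one} (h : v = v') (s : u ⟶ v) (t : u ⟶ v')
    (x : (zero : T.Ob).Ix → X.C) :
    (X.op₂ s pt).app x ≍ (X.op₂ t pt).app x := by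
  subst h
  rw [X.op₂_nullary_eq μ s t]

/-- At the unit, the unit laws for different places agree, since 2-cells between nullary operations
are unique. -/
theorem insIso_unit [∀ v : (zero : T.Ob) ⟶ one, IsIso (μ.gray v v)] (k l : n.Ix)
    (z : (zero : T.Ob).Ix → X.C) :
    (X.insIso U k ((X.op U.unit pt).obj z)).hom ≍ (X.insIso U l ((X.op U.unit pt).obj z)).hom := by
  have h (k : n.Ix) : (X.insIso U k ((X.op U.unit pt).obj z)).hom ≍
      (X.op₂ (U.unit ◁ (U.iso k).hom) pt).app z := by
    refine (X.insIso_hom_heq U k _).trans (HEq.trans ?_ (X.op₂_whiskerLeft _ _ _ _).symm)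
    exact app_hcongr _ (funext fun j => by rw [eq_pt j])
  refine (h k).trans (HEq.trans ?_ (h l).symm)
  refine X.op₂_nullary_hcongr μ ?_ _ _ z
  rw [← Category.assoc, ← Category.assoc, U.unit_ins k l]

theorem insIso_ins [∀ v : (zero : T.Ob) ⟶ one, IsIso (μ.gray v v)] (k l : n.Ix) (x : X.C) :
    (X.insIso U l ((X.op (U.ins k) l).obj fun _ => x)).hom ≍
      (X.insIso U k ((X.op (U.ins k) l).obj fun _ => x)).hom := by
  by_cases h : l = k
  · subst h; rfl
  · have e := X.op_ins_of_ne U h (fun _ => x) (fun j => isEmptyElim j)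
    exact (X.insIso_congr U l e).trans ((X.insIso_unit μ U l k _).trans
      (X.insIso_congr U k e.symm))

/-- The Gray cell of a unit insertion with itself is an identity: its entries are Gray cells
involving an identity 1-cell, or the Gray cell of the unit with itself. -/
theorem sig_ins_ins [∀ v : (zero : T.Ob) ⟶ one, IsIso (μ.gray v v)] (k i l : n.Ix)
    (M : (one : T.Ob).Ix → (one : T.Ob).Ix → X.C) :
    X.sig μ (U.ins k) (U.ins k) M i l ≍
      𝟙 ((X.op (U.ins k) i).obj fun j => (X.op (U.ins k) l).obj (M j)) := by
  refine (X.sig_comp_proj_left μ (U.ins k) (U.ins k) M i pt l).symm.trans ?_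
  refine (X.sig_comp_proj_right μ (U.ins k ≫ proj i) (U.ins k) M pt l pt).symm.trans ?_
  have e : 𝟙 ((X.op (U.ins k) i).obj fun j => (X.op (U.ins k) l).obj (M j)) ≍
      𝟙 ((X.op (U.ins k ≫ proj i) pt).obj fun j => (X.op (U.ins k ≫ proj l) pt).obj (M j)) := by
    rw [op_comp_proj, op_comp_proj]
  refine HEq.trans ?_ e.symm
  by_cases h : i = k
  · rw [h, U.ins_proj_self, ← θ_id]
    refine (X.sig_inert_left μ _ _ _ _ _).trans (id_hcongr ?_)
    rw [op_inert_obj]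
  by_cases h' : l = k
  · rw [h', U.ins_proj_self, ← θ_id]
    refine (X.sig_inert_right μ _ _ _ _ _).trans (id_hcongr ?_)
    simp only [op_inert_obj]
  rw [U.ins_proj_of_ne h, U.ins_proj_of_ne h']
  refine (X.sig_inert_comp_left μ _ _ _ _ _ _).trans ((X.sig_inert_comp_right μ _ _ _ _ _ _).trans
    ((X.sig_nullary μ U.unit _ fun j => isEmptyElim j).trans (id_hcongr ?_)))
  rw [op_comp_obj]
  exact congrArg _ (funext fun j => isEmptyElim j)

theorem op_map_isIso {m n : T.Ob} (α : m ⟶ n) (i : n.Ix) {x y : m.Ix → X.C}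
    (f : ∀ k, x k ⟶ y k) [∀ k, IsIso (f k)] : IsIso ((X.op α i).map f) :=
  have : IsIso (show x ⟶ y from f) := (isIso_pi_iff _).2 fun k => inferInstanceAs (IsIso (f k))
  inferInstance

/-- The tuple with `k`-th entry `x` and the value of the nullary operation elsewhere. -/
abbrev insTuple (k : n.Ix) (x : X.C) (l : n.Ix) : X.C := (X.op (U.ins k) l).obj fun _ => x

/-- Naturality of the Gray cells of `α` with respect to the unit law `𝟙 ⟶ ins k ≫ α` in the second
variable. -/
theorem map_insIso_sig (k : n.Ix) (y : n.Ix → X.C) :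
    (X.op α pt).map (fun l => (X.insIso U k (y l)).hom) ≫
        X.sig μ α α (fun l => X.insTuple U k (y l)) pt pt ≫
        (X.op α pt).map (fun i => X.sig μ α (U.ins k) (fun l _ => y l) pt i) =
      (X.insIso U k ((X.op α pt).obj y)).hom := by
  have h := X.sig_op₂_right μ α (U.iso k).hom (fun l _ => y l) pt pt
  have h₁ : X.sig μ α (𝟙 one) (fun l (_ : (one : T.Ob).Ix) => y l) pt pt ≍
      𝟙 ((X.op α pt).obj y) := by
    rw [← θ_id]
    exact X.sig_inert_right μ α id _ pt pt
  have h₂ := X.sig_comp_right μ α (U.ins k) α (fun l (_ : (one : T.Ob).Ix) => y l) pt pt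
  refine eq_of_heq (HEq.trans ?_ ((heq_of_eq h.symm).trans ((comp_heq_right ?_ ?_ h₁).trans
    (X.insIso_hom_heq U k _).symm)))
  · refine comp_hcongr ?_ ?_ ?_ (X.op_map_hcongr α pt ?_ ?_ fun l => X.insIso_hom_heq U k (y l))
      h₂.symm
    all_goals simp [op_id_obj, op_comp_obj]
  all_goals simp [op_id_obj]

/-- Naturality of the Gray cells with the unit insertion with respect to the unit law `𝟙 ⟶ ins k ≫
α` in the first variable. -/
theorem insIso_sig_ins [∀ v : (zero : T.Ob) ⟶ one, IsIso (μ.gray v v)] (k : n.Ix) (x : X.C)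
    (i : n.Ix) (c : X.insTuple U k x i ⟶ (X.op α pt).obj fun l =>
      X.insTuple U k (X.insTuple U k x l) i)
    (hc : c ≍ (X.insIso U k (X.insTuple U k x i)).hom) :
    c ≫ X.sig μ α (U.ins k) (fun l _ => X.insTuple U k x l) pt i =
      (X.op (U.ins k) i).map fun _ => (X.insIso U k x).hom := by
  have h := X.sig_op₂_left μ (U.iso k).hom (U.ins k) (fun _ _ => x) pt i
  have h₁ : X.sig μ (𝟙 one) (U.ins k) (fun _ (_ : (one : T.Ob).Ix) => x) pt i ≍
      𝟙 (X.insTuple U k x i) := by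
    rw [← θ_id]
    exact X.sig_inert_left μ id _ _ pt i
  have h₂ := X.sig_comp_left μ (U.ins k) α (U.ins k) (fun _ (_ : (one : T.Ob).Ix) => x) pt i
  have h₃ : X.sig μ (U.ins k ≫ α) (U.ins k) (fun _ (_ : (one : T.Ob).Ix) => x) pt i ≍
      X.sig μ α (U.ins k) (fun l _ => X.insTuple U k x l) pt i := by
    refine h₂.trans (comp_heq_right ?_ ?_ (X.op_map_heq_id α pt ?_ ?_
      fun l => X.sig_ins_ins μ U k l i _))
    · exact congrArg _ (funext fun l => X.ins_ins_obj U k l i _)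
    · rfl
    · exact fun l => rfl
    · exact fun l => (X.ins_ins_obj U k l i _).symm
  refine eq_of_heq (HEq.trans (comp_hcongr ?_ ?_ ?_ (hc.trans (X.insIso_hom_heq U k _)) h₃.symm)
    ((heq_of_eq h.symm).trans ((comp_heq_right ?_ ?_ h₁).trans
      (X.op_map_hcongr _ i ?_ ?_ fun _ => (X.insIso_hom_heq U k x).symm))))
  · simp [op_id_obj]
  · rw [op_comp_obj]
    exact congrArg _ (funext fun l => X.ins_ins_obj U k i l _)
  · simp [op_comp_obj]
  · simp [op_id_obj]
  · simp [op_id_obj]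
  · simp [op_id_obj]
  · simp [op_comp_obj]

theorem map_insIso_sig_ins [∀ v : (zero : T.Ob) ⟶ one, IsIso (μ.gray v v)] (k : n.Ix) (x : X.C)
    (c : ∀ i, X.insTuple U k x i ⟶ (X.op α pt).obj fun l =>
      X.insTuple U k (X.insTuple U k x l) i)
    [∀ i, IsIso (c i)] (hc : ∀ i, c i ≍ (X.insIso U k (X.insTuple U k x i)).hom) :
    (X.op α pt).map (fun l => (X.insIso U k (X.insTuple U k x l)).hom) ≫
        X.sig μ α α (fun l => X.insTuple U k (X.insTuple U k x l)) pt pt =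
      (X.op α pt).map c := by
  have hS (i : n.Ix) := X.insIso_sig_ins μ U k x i (c i) (hc i)
  let S (i : n.Ix) := X.sig μ α (U.ins k) (fun l _ => X.insTuple U k x l) pt i
  have hcS : (X.op α pt).map c ≫ (X.op α pt).map S =
      (X.op α pt).map fun i => (X.op (U.ins k) i).map fun _ => (X.insIso U k x).hom :=
    (X.op_map_comp α pt c S).symm.trans (congrArg _ (funext hS))
  -- The unit law `ι : 𝟙 ⟶ γ` with `γ = ins k ≫ α` satisfies `ι (γ x) = γ (ι x)`, since `ι x` is an
  -- epimorphism.
  have hE := X.insIso_naturality U k (X.insIso U k x).hom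
  rw [cancel_epi] at hE
  have hA := X.map_insIso_sig μ U k (X.insTuple U k x)
  have : ∀ i, IsIso (S i) := fun i => by
    have : IsIso (c i ≫ S i) := by
      rw [hS i]
      exact X.op_map_isIso _ _ _
    exact IsIso.of_isIso_comp_left (c i) (S i)
  have : IsIso ((X.op α pt).map S) := X.op_map_isIso _ _ _
  rw [← cancel_mono ((X.op α pt).map S), hcS, Category.assoc]
  exact hA.trans hE

/-- The rows and the columns of the unit matrix are collapsed compatibly with the Gray cell of `α`
for tuples with all but one entry a unit. -/
theorem map_rowIso_sig_insTuple [∀ v : (zero : T.Ob) ⟶ one, IsIso (μ.gray v v)] (k : n.Ix)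
    (x : X.C) :
    (X.op α pt).map (fun l => (X.rowIso U (X.insTuple U k x) l).hom) ≫
        X.sig μ α α (X.unitMat U (X.insTuple U k x)) pt pt =
      (X.op α pt).map fun l => (X.colIso U (X.insTuple U k x) l).hom := by
  have hs (l i) := X.ins_ins_obj U k i l fun _ => x
  have hM := X.unitMat_ins U k x
  have hM' (l i) := congrFun (congrFun hM l) i
  let c (i : n.Ix) : X.insTuple U k x i ⟶ (X.op α pt).obj fun l =>
      X.insTuple U k (X.insTuple U k x l) i :=
    (X.insIso U k _).hom ≫ eqToHom (congrArg (X.op α pt).obj (funext fun l => hs _ _))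
  have hc (i : n.Ix) : c i ≍ (X.insIso U k (X.insTuple U k x i)).hom := comp_eqToHom_heq _ _
  have : ∀ i, IsIso (c i) := fun i => by
    dsimp only [c]
    infer_instance
  refine eq_of_heq (HEq.trans (comp_hcongr rfl ?_ ?_ (X.op_map_hcongr α pt (fun _ => rfl) ?_
    fun l => X.insIso_ins μ U k l x) (X.sig_congr μ rfl rfl hM' pt pt))
    ((heq_of_eq (X.map_insIso_sig_ins μ U k x c hc)).trans
    (X.op_map_hcongr α pt (fun _ => rfl) ?_ fun l =>
      (hc l).trans ((X.insIso_ins μ U k l x).symm.trans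
        (X.colIso_hom_heq U (X.insTuple U k x) l).symm))))
  · rw [hM]
  · rw [hM]
  · intro l
    exact congrArg _ (funext fun i => hM' l i)
  · intro l
    exact congrArg _ (funext fun i => (hM' i l).symm)

/-- The rows and the columns of the unit matrix are collapsed compatibly with the Gray cell of `α`.
-/
theorem map_rowIso_sig [∀ v : (zero : T.Ob) ⟶ one, IsIso (μ.gray v v)] [IsIso (μ.gray α α)]
    (z : n.Ix → X.C) :
    (X.op α pt).map (fun l => (X.rowIso U z l).hom) ≫ X.sig μ α α (X.unitMat U z) pt pt =
      (X.op α pt).map fun l => (X.colIso U z l).hom := by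
  -- `t` is the endo-2-cell of `α` measuring the failure of the claim. It acts trivially on the
  -- columns of the unit matrix, hence, by its compatibility with the invertible Gray cell, on the
  -- tuple of values of `α` at the rows, and these are isomorphic to the entries of `z`.
  obtain ⟨t, ht⟩ := X.exists_op₂_swap U μ
  have hcol (y : n.Ix → X.C) : (X.op α pt).map (fun l => (X.colIso U y l).hom) ≫
      (X.op α pt).map (fun l => (X.colIso U y l).inv) = 𝟙 _ := by
    rw [← X.op_map_comp, ← X.op_map_id]
    exact congrArg _ (funext fun l => (X.colIso U y l).hom_inv_id)
  have h₀ (k : n.Ix) : (X.op₂ t pt).app (fun l => X.unitMat U z l k) = 𝟙 _ := by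
    rw [show (fun l => X.unitMat U z l k) = X.insTuple U k (z k) from
      funext fun l => X.unitMat_symm U z l k, ht, ← Category.assoc,
      X.map_rowIso_sig_insTuple μ U, hcol]
  have h₁ : (X.op₂ t pt).app (fun l => (X.op α pt).obj (X.unitMat U z l)) = 𝟙 _ := by
    have h := X.sig_op₂_left μ t α (X.unitMat U z) pt pt
    rw [← cancel_mono (X.sig μ α α (X.unitMat U z) pt pt), ← h, Category.id_comp]
    refine (congrArg (_ ≫ ·) ?_).trans (Category.comp_id _)
    exact (congrArg _ (funext h₀)).trans (X.op_map_id α pt _)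
  have h₂ : (X.op₂ t pt).app z = 𝟙 _ := by
    have h := X.op₂_naturality t pt (fun l => (X.rowIso U z l).hom)
    have := X.op_map_isIso α pt (fun l => (X.rowIso U z l).hom)
    rw [h₁, Category.comp_id] at h
    rw [← cancel_mono ((X.op α pt).map fun l => (X.rowIso U z l).hom), ← h, Category.id_comp]
  have h₃ := ht z
  have := X.op_map_isIso α pt (fun l => (X.colIso U z l).inv)
  rw [h₂, ← Category.assoc, ← hcol, cancel_mono] at h₃
  exact h₃.symm

end Model

/-! ### The Eckmann-Hilton argument -/

/-- The structure of an internal algebra of `X` on the object `x`, without the underlying functor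
from the terminal category. -/
structure AlgebraStructure (X : Model T) (x : X.C) where
  cell {m n : T.Ob} (α : m ⟶ n) (i : n.Ix) : (X.op α i).obj (fun _ => x) ⟶ x
  cell_op₂ {m n : T.Ob} {α β : m ⟶ n} (s : α ⟶ β) (i : n.Ix) :
    (X.op₂ s i).app (fun _ => x) ≫ cell β i = cell α i
  cell_inert {m n : T.Ob} (p : n.Ix → m.Ix) (i : n.Ix) : cell (θ p) i ≍ 𝟙 x
  cell_comp {m n k : T.Ob} (α : m ⟶ n) (β : n ⟶ k) (i : k.Ix) :
    cell (α ≫ β) i ≍ (X.op β i).map (fun j => cell α j) ≫ cell β i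

namespace AlgebraStructure

variable {X : Model T} {x : X.C} (a b : AlgebraStructure X x)

/-- The structure cells of `b` are homomorphisms for `a`, up to the Gray cells. -/
def Interchange (μ : T.LaxCommutativity) : Prop :=
  ∀ ⦃p q m n : T.Ob⦄ (β : p ⟶ q) (α : m ⟶ n) (j : q.Ix) (i : n.Ix),
    X.sig μ β α (fun _ _ => x) j i ≫ (X.op α i).map (fun _ => a.cell β j) ≫ b.cell α i =
      (X.op β j).map (fun _ => b.cell α i) ≫ a.cell β j

/-- The two structures have the same cells at the operation `α`. -/
def Agree {m n : T.Ob} (α : m ⟶ n) : Prop := ∀ i, a.cell α i = b.cell α i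

variable {a b}

theorem agree_inert {m n : T.Ob} (p : n.Ix → m.Ix) : Agree a b (θ p) := fun i =>
  eq_of_heq ((a.cell_inert p i).trans (b.cell_inert p i).symm)

theorem Agree.comp {m n k : T.Ob} {α : m ⟶ n} {β : n ⟶ k} (hα : Agree a b α) (hβ : Agree a b β) :
    Agree a b (α ≫ β) := fun i =>
  eq_of_heq ((a.cell_comp α β i).trans (HEq.trans (heq_of_eq (by
    rw [hβ i, show (fun j => a.cell α j) = fun j => b.cell α j from funext hα]))
    (b.cell_comp α β i).symm))

theorem cell_comp_proj (a : AlgebraStructure X x) {m n : T.Ob} (α : m ⟶ n) (i : n.Ix)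
    (j : (one : T.Ob).Ix) : a.cell (α ≫ proj i) j ≍ a.cell α i := by
  refine (a.cell_comp α (proj i) j).trans ((comp_heq_left ?_ ?_ (a.cell_inert _ j)).trans
    (X.op_inert_map _ j _))
  · simp [X.op_inert_obj]
  · simp [X.op_inert_obj]

theorem agree_of_proj {m n : T.Ob} {α : m ⟶ n} (h : ∀ i, Agree a b (α ≫ proj i)) : Agree a b α :=
  fun i => eq_of_heq ((a.cell_comp_proj α i pt).symm.trans
    ((heq_of_eq (h i pt)).trans (b.cell_comp_proj α i pt)))

theorem agree_of_operadicClosure {B : ∀ n : T.Ob, (n ⟶ one) → Prop}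
    (hB : ∀ n α, B n α → Agree a b α) {n : T.Ob} {α : n ⟶ one} (h : OperadicClosure B n α) :
    Agree a b α := by
  induction h with
  | id => rw [← θ_id]; exact agree_inert _
  | of α h => exact hB _ α h
  | comp k α β γ hγ _ _ ihα ihβ =>
    refine Agree.comp (agree_of_proj fun i => ?_) ihα
    rw [hγ i]
    exact (agree_inert _).comp (ihβ i)

theorem agree_of_isBasis {B : ∀ n : T.Ob, (n ⟶ one) → Prop} (h : IsBasis B)
    (hB : ∀ n α, B n α → Agree a b α) {m n : T.Ob} (α : m ⟶ n) : Agree a b α :=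
  agree_of_proj fun i => by
    obtain ⟨k, p, β, hβ, e⟩ := h.2 m (α ≫ proj i)
    rw [e]
    exact (agree_inert p).comp (agree_of_operadicClosure hB hβ)

variable {μ : T.LaxCommutativity}

theorem Interchange.agree_nullary (h : Interchange a b μ) (u : (zero : T.Ob) ⟶ one)
    [IsIso (μ.gray u u)] : Agree a b u := fun i => by
  have h := h u u pt pt
  rw [eq_pt i]
  have e (f : ∀ k : (zero : T.Ob).Ix, (X.op u pt).obj (fun _ => x) ⟶ x) :
      (X.op u pt).map f ≍ 𝟙 ((X.op u pt).obj fun _ => x) := X.op_map_zero u pt _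
  have hx : (fun _ : (zero : T.Ob).Ix => (X.op u pt).obj fun _ => x) = fun _ => x :=
    funext fun k => isEmptyElim k
  have hx' := congrArg (X.op u pt).obj hx
  have h₁ := X.sig_nullary μ u (fun _ _ => x) (fun _ => x)
  refine eq_of_heq (HEq.trans ?_ ((heq_of_eq h.symm).trans ?_))
  · exact (comp_heq_right hx' hx' (e _)).symm
  · refine (comp_heq_right rfl hx' h₁).trans (comp_heq_right hx' hx' (e _))

/-- The unit law of an algebra: mapping the entries of a row of the unit matrix to `x` by the
structure cells of the unit insertion and then applying the structure cell of `α` undoes `rowIso`.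
-/
theorem rowIso_cell {n : T.Ob} {α : n ⟶ one} (U : UnitalStructure α) (b : AlgebraStructure X x)
    (l : n.Ix) :
    (X.rowIso U (fun _ => x) l).hom ≫ (X.op α pt).map (fun k => b.cell (U.ins l) k) ≫
      b.cell α pt = 𝟙 x := by
  have h := b.cell_op₂ (U.iso l).hom pt
  have h₁ : b.cell (𝟙 one) pt ≍ 𝟙 x := by
    rw [← θ_id]
    exact b.cell_inert id pt
  refine eq_of_heq (HEq.trans (comp_hcongr ?_ ?_ ?_ (X.insIso_hom_heq U l x)
    (b.cell_comp (U.ins l) α pt).symm) ((heq_of_eq h).trans h₁))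
  · exact (X.op_id_obj pt fun _ => x).symm
  · exact (X.op_comp_obj _ _ _ _).symm
  · rfl

/-- The structure cells at the entries of the unit insertions form a symmetric matrix, like
`unitMat`. -/
theorem cell_ins_symm {n : T.Ob} {α : n ⟶ one} (U : UnitalStructure α)
    (b : AlgebraStructure X x) (l k : n.Ix) :
    b.cell (U.ins l) k ≍ b.cell (U.ins k) l := by
  have h (l k : n.Ix) : b.cell (proj l ≫ U.ins l ≫ proj k) pt ≍ b.cell (U.ins l) k := by
    refine (b.cell_comp _ _ _).trans ((comp_heq_right ?_ ?_ (X.op_map_heq_id _ _ ?_ ?_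
      fun j => b.cell_inert _ j)).trans (b.cell_comp_proj _ k pt))
    all_goals simp [proj, X.op_inert_obj]
  refine (h l k).symm.trans (HEq.trans ?_ (h k l))
  rw [U.proj_ins_proj]

theorem colIso_cell {n : T.Ob} {α : n ⟶ one} (U : UnitalStructure α) (b : AlgebraStructure X x)
    (k : n.Ix) :
    (X.colIso U (fun _ => x) k).hom ≫ (X.op α pt).map (fun l => b.cell (U.ins l) k) ≫
      b.cell α pt = 𝟙 x := by
  have hs := X.unitMat_symm U (fun _ => x)
  refine eq_of_heq (HEq.trans (comp_hcongr rfl ?_ rfl (X.colIso_hom_heq U _ k)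
    (comp_hcongr ?_ rfl rfl (X.op_map_hcongr α pt ?_ (fun _ => rfl) fun l =>
      b.cell_ins_symm U l k) HEq.rfl))
    (heq_of_eq (b.rowIso_cell U k)))
  · exact congrArg _ (funext fun l => hs l k)
  · exact congrArg _ (funext fun l => hs l k)
  · exact fun l => hs l k

theorem Agree.ins {n : T.Ob} {α : n ⟶ one} (U : UnitalStructure α) (h : Agree a b U.unit)
    (k : n.Ix) : Agree a b (U.ins k) := agree_of_proj fun i => by
  by_cases hi : i = k
  · rw [hi, U.ins_proj_self, ← θ_id]
    exact agree_inert _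
  · rw [U.ins_proj_of_ne hi]
    exact (agree_inert _).comp h

/-- The Eckmann-Hilton argument: both structure cells at `α` are restrictions of the common value of
the interchange law at the constant matrix along the unit matrix. -/
theorem Interchange.agree_unital (h : Interchange a b μ)
    [∀ v : (zero : T.Ob) ⟶ one, IsIso (μ.gray v v)] {n : T.Ob} {α : n ⟶ one} [IsIso (μ.gray α α)]
    (U : UnitalStructure α) : Agree a b α := fun i => by
  rw [eq_pt i]
  have hD (l k : n.Ix) : a.cell (U.ins l) k = b.cell (U.ins l) k :=
    Agree.ins U (h.agree_nullary U.unit) l k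
  have hr := b.rowIso_cell U
  have hc := a.colIso_cell U
  simp only [hD] at hc
  have hsw := X.map_rowIso_sig μ U (fun _ => x)
  have hn := X.sig_natural μ α α (M := X.unitMat U fun _ => x) (M' := fun _ _ => x)
    (fun l k => b.cell (U.ins l) k) pt pt
  have hi := h α α pt pt
  calc a.cell α pt = (X.op α pt).map (fun l => (X.rowIso U (fun _ => x) l).hom ≫
        (X.op α pt).map (fun k => b.cell (U.ins l) k) ≫ b.cell α pt) ≫ a.cell α pt := by
        rw [funext hr, X.op_map_id, Category.id_comp]
    _ = (X.op α pt).map (fun l => (X.rowIso U (fun _ => x) l).hom) ≫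
        ((X.op α pt).map (fun l => (X.op α pt).map fun k => b.cell (U.ins l) k) ≫
          X.sig μ α α (fun _ _ => x) pt pt) ≫ (X.op α pt).map (fun _ => a.cell α pt) ≫
            b.cell α pt := by
        simp only [X.op_map_comp, Category.assoc]
        rw [hi]
    _ = (X.op α pt).map (fun k => (X.colIso U (fun _ => x) k).hom ≫
        (X.op α pt).map (fun l => b.cell (U.ins l) k) ≫ a.cell α pt) ≫ b.cell α pt := by
        rw [← hn]
        simp only [X.op_map_comp, Category.assoc]
        rw [← hsw]
        simp only [Category.assoc]
    _ = b.cell α pt := by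
        rw [funext hc, X.op_map_id, Category.id_comp]

theorem Interchange.agree (h : Interchange a b μ) (hμ : μ.IsEckmannHilton) {m n : T.Ob}
    (α : m ⟶ n) : Agree a b α := by
  obtain ⟨B, hB, h₁, h₂, h₃, h₄⟩ := hμ
  have : ∀ v : (zero : T.Ob) ⟶ one, IsIso (μ.gray v v) := fun v => h₄ v v
  refine agree_of_isBasis hB (fun n α hα => ?_) α
  have hn : n = zero ∨ n = one ∨ 2 ≤ n.card := by
    obtain ⟨_ | _ | n⟩ := n
    · exact Or.inl rfl
    · exact Or.inr (Or.inl rfl)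
    · exact Or.inr (Or.inr (Nat.le_add_left 2 n))
  obtain rfl | rfl | hn := hn
  · exact h.agree_nullary α
  · exact (h₁ α hα).elim
  · obtain ⟨U⟩ := (h₂ n α hα hn).nonempty_unitalStructure
    have := h₃ n α hα
    exact h.agree_unital U

end AlgebraStructure

/-! ### Idempotency -/

/-- The algebra structure underlying a lax homomorphism out of the terminal model. -/
def LaxHom.algebraStructure {X : Model T} (f : LaxHom (terminalModel T) X) :
    AlgebraStructure X (f.F.obj ⟨PUnit.unit⟩) where
  cell α i := f.cell α (fun _ => ⟨PUnit.unit⟩) i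
  cell_op₂ s i := (f.cell_op₂ s (fun _ => ⟨PUnit.unit⟩) i).symm.trans <|
    (congrArg (_ ≫ ·) (f.F.map_id _)).trans (Category.comp_id _)
  cell_inert p i := f.cell_inert p _ i
  cell_comp α β i := f.cell_comp α β _ i

/-- An internal algebra of `IntAlg X` carries two algebra structures on one object of `X`, that of
its underlying internal algebra and that of its evaluation. By the Eckmann-Hilton argument they are
equal, so that the internal algebra is a diagonal. -/
theorem LaxHom.diag_eval (μ : T.LaxCommutativity) (hμ : μ.IsEckmannHilton) {X : Model T}
    (φ : LaxHom (terminalModel T) (internalHom μ (terminalModel T) X)) :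
    LaxHom.diag μ (φ.F.obj ⟨PUnit.unit⟩) = φ := by
  have h : AlgebraStructure.Interchange (LaxHom.algebraStructure (φ.F.obj ⟨PUnit.unit⟩))
      (LaxHom.algebraStructure (LaxHom.comp φ (intAlgEval μ X))) μ := fun p q m n β α j i => by
    have h := (φ.cell α (fun _ => ⟨PUnit.unit⟩) i).comm β (fun _ => ⟨PUnit.unit⟩) j
    have e : (LaxHom.algebraStructure (LaxHom.comp φ (intAlgEval μ X))).cell α i =
        (φ.cell α (fun _ => ⟨PUnit.unit⟩) i).app.app ⟨PUnit.unit⟩ := Category.id_comp _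
    rw [e]
    exact (Category.assoc _ _ _).symm.trans h
  refine LaxHom.hext (fun _ => rfl) (fun _ => heq_of_eq (φ.F.map_id _).symm) fun α y i =>
    heq_of_eq (LaxHom.hom_ext fun z => ?_)
  exact (h.agree hμ α i).trans (Category.id_comp _)

theorem mainTheorem2 (T : LawvereTwoTheory.{w, u}) (μ : T.LaxCommutativity) :
    ∃ W : TwoComonad (intAlg μ), (∀ X : Model T, W.counit X = intAlgEval μ X) ∧
      (μ.IsEckmannHilton → W.IsIdempotent) := by
  refine ⟨intAlgComonad μ, fun X => rfl, fun hμ X => ⟨intAlgEval μ _,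
    (intAlgComonad μ).counit_left X, ?_⟩⟩
  refine LaxHom.hext (fun φ => LaxHom.diag_eval μ hμ φ)
    (fun t => LaxHom.hom_hext (LaxHom.diag_eval μ hμ _) (LaxHom.diag_eval μ hμ _)
      fun y => HEq.rfl) fun α f i => ?_
  refine LaxHom.hom_hext (LaxHom.opHom_hcongr μ α i fun k => LaxHom.diag_eval μ hμ (f k))
    (LaxHom.diag_eval μ hμ (LaxHom.opHom μ α i f)) fun y => heq_of_eq ?_
  exact Category.comp_id _
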